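/- Let $d\ge 1$ and let $Z(t)$, $t\in\mathbb{R}^d$, be a non-negative random field with almost surely càdlàg paths (at every point limits exist from all octants, with continuity from the octant $\{s: s_i\ge t_i\ \forall i\}$), such that $\mathbb{E}[Z(t)]=1$ for all $t$, $\mathbb{E}[\sup_{t\in[0,T]^d}Z(t)]<\infty$ for all $T>0$ and $\mathbb{P}(\sup_{t\in\mathbb{R}^d}Z(t)>0)=1$. Assume that $Z$ is the spectral random field of a stationary max-stable random field $X$, i.e. $X(t)=\max_{i\ge 1}\Gamma_i^{-1}Z^{(i)}(t)$, $t\in\mathbb{R}^d$, is stationary, where $\Gamma_i=\mathcal V_1+\dots+\mathcal V_i$ with $\mathcal V_k$ independent unit exponential random variables that are independent of the independent copies $Z^{(i)}$ of $Z$. For $\delta>0$ let $\lambda_\delta$ be $\delta^d$ times the counting measure on $\delta\mathbb{Z}^d$; let $\lambda_0$ be the Lebesgue measure and $0\mathbb{Z}^d=\mathbb{R}^d$. For $\delta,x\ge 0$ define the Berman function $$\mathcal{B}_Z^\delta(x)=\lim_{T\to\infty}\frac1{T^d}\int_0^\infty \mathbb{P}\Bigl(\int_{[0,T]^d\cap\delta\mathbb{Z}^d}\mathbb{I}(Z(t)>s)\,\lambda_\delta(dt)>x\Bigr)ds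 .$$ Let $\Theta$ be a random field with càdlàg paths and law $\mu(A)=\mathbb{E}[Z(0)\,\mathbb{I}(Z/Z(0)\in A)]$, let $R$ be independent of $\Theta$ with $\mathbb{P}(R>r)=1/r$, $r\ge 1$, and put $Y(t)=R\,\Theta(t)$ and $\epsilon_\delta(Y)=\int_{\delta\mathbb{Z}^d}\mathbb{I}(Y(t)>1)\,\lambda_\delta(dt)\in[0,\infty]$. Let $S_0=\int_{\mathbb{R}^d}Z(t)\,dt$ and suppose that $\mathbb{P}(S_0=\infty)<1$. Then: (i) If $Z$ has almost surely continuous trajectories, then the distribution of $\epsilon_0(Y)$ is continuous on $[0,\infty)$, i.e. $\mathbb{P}(\epsilon_0(Y)=x)=0$ for every $x\in[0,\infty)$. (ii) For all $\delta,x\ge 0$ with $\mathbb{P}(x<\epsilon_\delta(Y)<\infty)>0$, the limit defining $\mathcal{B}_Z^\delta(x)$ exists and $0<\mathcal{B}_Z^\delta(x)<\infty$. (iii) If $\mathbb{P}(S_0<\infty)=1$, then $\mathbb{P}(\epsilon_\delta(Y)<\infty)=1$ for every $\delta\ge 0$. Hence in this case the distribution of $\epsilon_0(Y)$ in (i) is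 a continuous distribution on $[0,\infty)$, and the condition in (ii) is $\mathbb{P}(\epsilon_\delta(Y)>x)>0$. -/

import Mathlib

open MeasureTheory ProbabilityTheory Filter Topology
open scoped ENNReal

noncomputable section

namespace Berman

/-- The octant at `t` with sign pattern `σ`: the points `s` with `t i ≤ s i` where `σ i` is true
and `s i < t i` where `σ i` is false. -/
def octant {d : ℕ} (t : Fin d → ℝ) (σ : Fin d → Bool) : Set (Fin d → ℝ) :=
  {s | ∀ i, (σ i = true → t i ≤ s i) ∧ (σ i = false → s i < t i)}

/-- The space `D` of non-negative (generalised) càdlàg functions on `ℝ^d`: limits exist (in `ℝ`)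
from every octant, and the function is continuous from the upper right octant. -/
def cadlagSpace (d : ℕ) : Set ((Fin d → ℝ) → ℝ) :=
  {f | (∀ t, 0 ≤ f t) ∧
    ∀ t, ContinuousWithinAt f (Set.Ici t) t ∧
      ∀ σ : Fin d → Bool, ∃ l : ℝ, Tendsto f (𝓝[octant t σ] t) (𝓝 l)}

/-- The set `δ ℤ^d`, with the convention `0 ℤ^d = ℝ^d`. -/
def grid (d : ℕ) (δ : ℝ) : Set (Fin d → ℝ) :=
  {t | δ = 0 ∨ ∃ k : Fin d → ℤ, t = fun i => δ * (k i : ℝ)}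

open Classical in
/-- The measure `λ_δ`: Lebesgue measure on `ℝ^d` if `δ = 0`, and `δ^d` times the counting measure
on `δ ℤ^d` if `δ > 0`. -/
def gridMeasure (d : ℕ) (δ : ℝ) : Measure (Fin d → ℝ) :=
  if δ = 0 then volume
  else ENNReal.ofReal (δ ^ d) •
    Measure.sum fun k : Fin d → ℤ => Measure.dirac fun i => δ * (k i : ℝ)

/-- The sojourn `∫_{A ∩ δ ℤ^d} 𝟙(f(t) > s) λ_δ(dt)`. -/
def sojourn {d : ℕ} (δ : ℝ) (A : Set (Fin d → ℝ)) (f : (Fin d → ℝ) → ℝ) (s : ℝ) : ℝ≥0∞ :=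
  gridMeasure d δ {t | t ∈ A ∩ grid d δ ∧ s < f t}

/-- `ε_δ(f) = ∫_{δ ℤ^d} 𝟙(f(t) > 1) λ_δ(dt)`. -/
def epsilon {d : ℕ} (δ : ℝ) (f : (Fin d → ℝ) → ℝ) : ℝ≥0∞ :=
  sojourn δ Set.univ f 1

/-- `S_0(f) = ∫_{ℝ^d} f(t) dt` for non-negative `f`. -/
def totalMass {d : ℕ} (f : (Fin d → ℝ) → ℝ) : ℝ≥0∞ :=
  ∫⁻ t, ENNReal.ofReal (f t)

/-- The cube `[0,T]^d`. -/
def cube (d : ℕ) (T : ℝ) : Set (Fin d → ℝ) :=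
  Set.Icc (fun _ => 0) (fun _ => T)

section Fields

variable {d : ℕ} {Ω : Type*} [MeasurableSpace Ω]

/-- `B_Z^δ([0,T]^d ∩ δ ℤ^d, x)`. -/
def bermanOn (P : Measure Ω) (Z : (Fin d → ℝ) → Ω → ℝ) (δ x T : ℝ) : ℝ≥0∞ :=
  ∫⁻ s in Set.Ioi (0 : ℝ),
    P {ω | ENNReal.ofReal x < sojourn δ (cube d T) (fun t => Z t ω) s}

/-- `T^{-d} B_Z^δ([0,T]^d ∩ δ ℤ^d, x)`. -/
def bermanRatio (P : Measure Ω) (Z : (Fin d → ℝ) → Ω → ℝ) (δ x T : ℝ) : ℝ≥0∞ :=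
  bermanOn P Z δ x T / ENNReal.ofReal (T ^ d)

/-- The Berman function `B_Z^δ(x) = lim_{T → ∞} T^{-d} B_Z^δ([0,T]^d ∩ δ ℤ^d, x)`; meaningful
when the limit exists. -/
def bermanFunction (P : Measure Ω) (Z : (Fin d → ℝ) → Ω → ℝ) (δ x : ℝ) : ℝ≥0∞ :=
  limUnder atTop (bermanRatio P Z δ x)

/-- The standing assumptions on the non-negative random field `Z` itself. -/
structure IsSpectralField (P : Measure Ω) (Z : (Fin d → ℝ) → Ω → ℝ) : Prop where
  measurable : ∀ t, Measurable (Z t)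
  paths : ∀ᵐ ω ∂P, (fun t => Z t ω) ∈ cadlagSpace d
  mean_one : ∀ t, ∫ ω, Z t ω ∂P = 1
  sup_integrable : ∀ T : ℝ, 0 < T →
    ∫⁻ ω, ⨆ t ∈ cube d T, ENNReal.ofReal (Z t ω) ∂P < ∞
  sup_pos : ∀ᵐ ω ∂P, ∃ t, 0 < Z t ω

/-- `V` are independent unit exponential variables, independent of the independent copies `Zs i`
of the random field `Z`. -/
structure IsDeHaanFamily (P : Measure Ω) (Z : (Fin d → ℝ) → Ω → ℝ)
    {Ω' : Type*} [MeasurableSpace Ω'] (P' : Measure Ω')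
    (V : ℕ → Ω' → ℝ) (Zs : ℕ → (Fin d → ℝ) → Ω' → ℝ) : Prop where
  measurable_exp : ∀ k, Measurable (V k)
  law_exp : ∀ k, P'.map (V k) = expMeasure 1
  indep_exp : iIndepFun V P'
  measurable_copy : ∀ i t, Measurable (Zs i t)
  law_copy : ∀ i, P'.map (fun ω t => Zs i t ω) = P.map (fun ω t => Z t ω)
  indep_copy : iIndepFun (fun i ω t => Zs i t ω) P'
  indep : IndepFun (fun ω k => V k ω) (fun ω i t => Zs i t ω) P'

/-- The max-stable field `X(t) = max_i Γ_i⁻¹ Z^{(i)}(t)`, with `Γ_i` the partial sums of `V`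
(indices start at `0` here, so that `Γ_i = V_0 + ... + V_i`). -/
def maxStableField {Ω' : Type*} (V : ℕ → Ω' → ℝ) (Zs : ℕ → (Fin d → ℝ) → Ω' → ℝ)
    (t : Fin d → ℝ) (ω : Ω') : ℝ≥0∞ :=
  ⨆ i : ℕ, ENNReal.ofReal ((∑ k ∈ Finset.range (i + 1), V k ω)⁻¹ * Zs i t ω)

/-- (Strict) stationarity of a random field: all shifts have the same finite-dimensional
distributions, that is, the same law on the product space. -/
def IsStationary (P : Measure Ω) (X : (Fin d → ℝ) → Ω → ℝ≥0∞) : Prop :=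
  ∀ h : Fin d → ℝ, IdentDistrib (fun ω t => X (t + h) ω) (fun ω t => X t ω) P P

/-- `Θ` is a random field with càdlàg paths and law
`μ(A) = E[Z(0) 𝟙(Z / Z(0) ∈ A)]`. -/
structure IsTilted (P : Measure Ω) (Z : (Fin d → ℝ) → Ω → ℝ)
    {Ω' : Type*} [MeasurableSpace Ω'] (Q : Measure Ω') (Θ : (Fin d → ℝ) → Ω' → ℝ) : Prop where
  measurable : ∀ t, Measurable (Θ t)
  paths : ∀ᵐ ω ∂Q, (fun t => Θ t ω) ∈ cadlagSpace d
  law : Q.map (fun ω t => Θ t ω) =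
    (P.withDensity fun ω => ENNReal.ofReal (Z 0 ω)).map (fun ω t => Z t ω / Z 0 ω)

end Fields

end Berman

end

/-!
The *tail measure* `ν` of `Z` is the law of `Z / s` under `P(dω) ds` on `Ω × (0, ∞)`. The law of the
max-stable field `X` determines the integrals of `max_j Z(t_j) / y_j`, through the tails of
`max_j X(t_j) / y_j`; these are the `ν`-measures of the events that a path exceeds one of the levels
`y_j` at its point `t_j`, and they determine `ν`. Stationarity of `X` therefore means that `ν` is
shift invariant. The law of `Y` is `ν` restricted to the paths that exceed `1` at the origin, and
the Berman ratio over `[0, T]^d` is `T^{-d} ν(l > x)`, where `l` is the sojourn time above `1` in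
the cube.

(i) For a continuous path, the volume of the superlevel sets is strictly decreasing in the level
as long as it is finite, so that at most one `s` gives `Z / s` a prescribed sojourn time.

(ii) Spreading the event `l > x` over its exceedance points and shifting each of them to the origin
turns the Berman ratio into an average over the cube, which tends to `E[𝟙(ε_δ(Y) > x) / ε_δ(Y)]`
when `δ` or `x` is positive, since then `1 / l` is bounded. For `δ = x = 0` this average still
bounds the limit from below, while the limit exists and is finite because `ν(l > 0)` is subadditive
in the cube.

(iii) Markov's inequality bounds `ε_0` by `S_0 / s`. For `δ > 0`, let each exceedance point of
`δ ℤ^d` send to every cell of that lattice the share of the excursion volume in the cell; by shift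
invariance the mean mass received equals the mean mass sent, so that it is finite, and hence so is
the number of exceedance points.
-/

noncomputable section

namespace Berman

open scoped NNReal

section RightContinuous

variable {ι α β : Type*} [MeasurableSpace α]

lemma tendsto_ceil_add_one_mul_div (t : ℝ) :
    Tendsto (fun n : ℕ => (⌈((n : ℝ) + 1) * t⌉ : ℝ) / (n + 1)) atTop (𝓝[≥] t) := by
  have hn (n : ℕ) : (0 : ℝ) < n + 1 := by positivity
  have hlower (n : ℕ) : t ≤ (⌈((n : ℝ) + 1) * t⌉ : ℝ) / (n + 1) := by
    rw [le_div_iff₀ (hn n), mul_comm]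
    exact Int.le_ceil _
  have hupper (n : ℕ) : (⌈((n : ℝ) + 1) * t⌉ : ℝ) / (n + 1) ≤ t + 1 / ((n : ℝ) + 1) := by
    have h := Int.ceil_lt_add_one (((n : ℝ) + 1) * t)
    have hsum : (t + 1 / ((n : ℝ) + 1)) * (n + 1) = (n + 1) * t + 1 := by field_simp
    rw [div_le_iff₀ (hn n), hsum]
    exact h.le
  refine tendsto_nhdsWithin_iff.2 ⟨?_, .of_forall hlower⟩
  refine tendsto_of_tendsto_of_tendsto_of_le_of_le tendsto_const_nhds ?_ hlower hupper
  simpa using tendsto_const_nhds.add (tendsto_one_div_add_atTop_nhds_zero_nat (𝕜 := ℝ))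

/-- Evaluate the field at the grid points `⌈(n + 1) t⌉ / (n + 1)`, which decrease to `t`. -/
lemma measurable_uncurry_of_continuousWithinAt_Ici [Finite ι] [TopologicalSpace β]
    [TopologicalSpace.PseudoMetrizableSpace β] [MeasurableSpace β] [BorelSpace β]
    {u : α → (ι → ℝ) → β} (hu : ∀ t, Measurable fun a => u a t)
    (hc : ∀ a t, ContinuousWithinAt (u a) (Set.Ici t) t) :
    Measurable (Function.uncurry u) := by
  let gridPoint (n : ℕ) (k : ι → ℤ) : ι → ℝ := fun i => (k i : ℝ) / (n + 1)
  let index (n : ℕ) (t : ι → ℝ) : ι → ℤ := fun i => ⌈((n : ℝ) + 1) * t i⌉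
  have hlim (t : ι → ℝ) :
      Tendsto (fun n => gridPoint n (index n t)) atTop (𝓝[Set.Ici t] t) := by
    have h i := tendsto_nhdsWithin_iff.1 (tendsto_ceil_add_one_mul_div (t i))
    refine tendsto_nhdsWithin_iff.2 ⟨tendsto_pi_nhds.2 fun i => (h i).1, ?_⟩
    filter_upwards [eventually_all.2 fun i => (h i).2] with n hn i using hn i
  refine measurable_of_tendsto_metrizable
    (f := fun n (p : α × (ι → ℝ)) => u p.1 (gridPoint n (index n p.2))) (fun n => ?_)
    (tendsto_pi_nhds.2 fun p => (hc p.1 p.2).tendsto.comp (hlim p.2))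
  have hgrid : Measurable fun p : α × (ι → ℤ) => u p.1 (gridPoint n p.2) :=
    measurable_from_prod_countable_left fun k => hu (gridPoint n k)
  have hindex : Measurable (index n) := measurable_pi_iff.2 fun i =>
    Int.measurable_ceil.comp ((measurable_pi_apply i).const_mul _)
  exact hgrid.comp (measurable_fst.prodMk (hindex.comp measurable_snd))

end RightContinuous

section Paths

variable {d : ℕ}

lemma tendsto_add_octant (t h : Fin d → ℝ) (σ : Fin d → Bool) :
    Tendsto (· + h) (𝓝[octant t σ] t) (𝓝[octant (t + h) σ] (t + h)) := by
  refine tendsto_nhdsWithin_iff.2 ⟨?_, ?_⟩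
  · exact ((continuous_id.add continuous_const).tendsto t).mono_left nhdsWithin_le_nhds
  · filter_upwards [self_mem_nhdsWithin] with s hs i
    simpa using hs i

lemma comp_add_right_mem_cadlagSpace {f : (Fin d → ℝ) → ℝ} (hf : f ∈ cadlagSpace d)
    (h : Fin d → ℝ) : (fun t => f (t + h)) ∈ cadlagSpace d := by
  refine ⟨fun t => hf.1 _, fun t => ⟨?_, fun σ => ?_⟩⟩
  · exact (hf.2 (t + h)).1.comp (f := (· + h))
      (continuous_id.add continuous_const).continuousWithinAt
      fun s hs => add_le_add_left (Set.mem_Ici.1 hs) h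
  · obtain ⟨l, hl⟩ := (hf.2 (t + h)).2 σ
    exact ⟨l, hl.comp (tendsto_add_octant t h σ)⟩

lemma const_mul_mem_cadlagSpace {f : (Fin d → ℝ) → ℝ} (hf : f ∈ cadlagSpace d) {c : ℝ}
    (hc : 0 ≤ c) : (fun t => c * f t) ∈ cadlagSpace d := by
  refine ⟨fun t => mul_nonneg hc (hf.1 t), fun t => ⟨?_, fun σ => ?_⟩⟩
  · exact continuousWithinAt_const.mul (hf.2 t).1
  · obtain ⟨l, hl⟩ := (hf.2 t).2 σ
    exact ⟨c * l, hl.const_mul c⟩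

lemma zero_mem_cadlagSpace : (fun _ => 0) ∈ cadlagSpace d :=
  ⟨fun _ => le_rfl, fun _ => ⟨continuousWithinAt_const, fun _ => ⟨0, tendsto_const_nhds⟩⟩⟩

/-- The path space `D`, with the σ-algebra generated by the evaluations. -/
abbrev Path (d : ℕ) : Type := cadlagSpace d

/-- The shift `f ↦ f(· + h)` of path space. -/
def shift (h : Fin d → ℝ) (f : Path d) : Path d :=
  ⟨fun t => f.1 (t + h), comp_add_right_mem_cadlagSpace f.2 h⟩

/-- The path `c f`, for a factor `c ≥ 0`. -/
def scale (c : ℝ≥0) (f : Path d) : Path d :=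
  ⟨fun t => c * f.1 t, const_mul_mem_cadlagSpace f.2 c.2⟩

lemma measurable_eval (t : Fin d → ℝ) : Measurable fun f : Path d => f.1 t :=
  (measurable_pi_apply t).comp measurable_subtype_coe

lemma measurableSet_lt_eval (s : ℝ) (t : Fin d → ℝ) : MeasurableSet {f : Path d | s < f.1 t} :=
  measurableSet_lt measurable_const (measurable_eval t)

lemma measurable_path_iff {α : Type*} [MeasurableSpace α] {g : α → Path d} :
    Measurable g ↔ ∀ t, Measurable fun a => (g a).1 t :=
  ⟨fun h t => (measurable_eval t).comp h, fun h => (measurable_pi_iff.2 h).subtype_mk⟩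

lemma measurable_shift (h : Fin d → ℝ) : Measurable (shift h) :=
  measurable_path_iff.2 fun t => measurable_eval (t + h)

lemma measurable_uncurry_scale : Measurable fun p : ℝ≥0 × Path d => scale p.1 p.2 :=
  measurable_path_iff.2 fun t =>
    measurable_fst.coe_nnreal_real.mul ((measurable_eval t).comp measurable_snd)

lemma scale_inv_toNNReal_apply {s : ℝ} (hs : 0 ≤ s) (f : Path d) (t : Fin d → ℝ) :
    (scale s⁻¹.toNNReal f).1 t = f.1 t / s := by
  simp only [scale, Real.coe_toNNReal _ (inv_nonneg.2 hs), div_eq_inv_mul]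

lemma measurable_uncurry_path : Measurable fun p : Path d × (Fin d → ℝ) => p.1.1 p.2 :=
  measurable_uncurry_of_continuousWithinAt_Ici measurable_eval fun f t => (f.2.2 t).1

lemma measurableSet_superlevel (f : Path d) (s : ℝ) : MeasurableSet {t | s < f.1 t} :=
  measurableSet_lt measurable_const (measurable_uncurry_path.comp measurable_prodMk_left)

lemma exists_measurable_path_ae_eq {Ω : Type*} [MeasurableSpace Ω] {P : Measure Ω}
    {X : (Fin d → ℝ) → Ω → ℝ} (hX : ∀ t, Measurable (X t))
    (hc : ∀ᵐ ω ∂P, (fun t => X t ω) ∈ cadlagSpace d) :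
    ∃ X' : Ω → Path d, Measurable X' ∧ ∀ᵐ ω ∂P, (X' ω).1 = fun t => X t ω := by
  obtain ⟨g, hg, hrange, hae⟩ := (measurable_pi_iff.2 hX).aemeasurable.exists_ae_eq_range_subset
    hc ⟨_, zero_mem_cadlagSpace⟩
  exact ⟨fun ω => ⟨g ω, hrange ⟨ω, rfl⟩⟩, hg.subtype_mk, hae.symm⟩

lemma exists_box_superlevel (f : Path d) {s : ℝ} {t : Fin d → ℝ} (h : s < f.1 t) :
    ∃ ε > 0, ∀ u, (∀ i, t i ≤ u i ∧ u i < t i + ε) → s < f.1 u := by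
  obtain ⟨ε, hε, hball⟩ := Metric.mem_nhdsWithin_iff.1 ((f.2.2 t).1.eventually (lt_mem_nhds h))
  refine ⟨ε, hε, fun u hu => hball ⟨?_, fun i => (hu i).1⟩⟩
  rw [Metric.mem_ball, dist_pi_lt_iff hε]
  intro i
  rw [Real.dist_eq, abs_of_nonneg (by linarith [(hu i).1])]
  linarith [(hu i).2]

lemma exists_rat_superlevel (f : Path d) {s : ℝ} {t : Fin d → ℝ} (h : s < f.1 t) :
    ∃ q : Fin d → ℚ, s < f.1 fun i => (q i : ℝ) := by
  obtain ⟨ε, hε, hbox⟩ := exists_box_superlevel f h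
  choose q hq using fun i => exists_rat_btwn (show t i < t i + ε by linarith)
  exact ⟨q, hbox _ fun i => ⟨(hq i).1.le, (hq i).2⟩⟩

end Paths

section Renewal

lemma expMeasure_Iio {r : ℝ} (hr : 0 < r) {a : ℝ} (ha : 0 ≤ a) :
    expMeasure r (Set.Iio a) = ENNReal.ofReal (1 - Real.exp (-(r * a))) := by
  rw [show expMeasure r = volume.withDensity (exponentialPDF r) from rfl,
    withDensity_apply _ measurableSet_Iio, setLIntegral_congr Iio_ae_eq_Iic,
    lintegral_exponentialPDF_eq_antiDeriv hr, if_pos ha]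

lemma expMeasure_Iio_of_nonpos {r a : ℝ} (ha : a ≤ 0) : expMeasure r (Set.Iio a) = 0 := by
  rw [show expMeasure r = volume.withDensity (exponentialPDF r) from rfl,
    withDensity_apply _ measurableSet_Iio]
  exact lintegral_exponentialPDF_of_nonpos ha

lemma lintegral_ofReal_sub_eq_lintegral_measure_Iio (μ : Measure ℝ) (a : ℝ) :
    ∫⁻ v, ENNReal.ofReal (a - v) ∂μ = ∫⁻ t in Set.Ioi 0, μ (Set.Iio (a - t)) := by
  have h := lintegral_eq_lintegral_meas_lt μ (f := fun v => max (a - v) 0)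
    (.of_forall fun v => le_max_right _ _) (by fun_prop)
  simp only [ENNReal.ofReal_max, ENNReal.ofReal_zero, max_eq_left zero_le] at h
  rw [h]
  refine setLIntegral_congr_fun measurableSet_Ioi fun t ht => congrArg μ (Set.ext fun v => ?_)
  simp [(Set.mem_Ioi.1 ht).not_gt, lt_sub_comm]

lemma lintegral_sub_expMeasure {r : ℝ} (hr : 0 < r) {a : ℝ} (ha : 0 ≤ a) :
    ∫⁻ v, ENNReal.ofReal (a - v) ∂(expMeasure r) =
      ENNReal.ofReal (a - (1 - Real.exp (-(r * a))) / r) := by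
  have hcut : ∫⁻ t in Set.Ioi 0, expMeasure r (Set.Iio (a - t)) =
      ∫⁻ t in Set.Ioc 0 a, ENNReal.ofReal (1 - Real.exp (-(r * (a - t)))) := by
    rw [← Set.Ioc_union_Ioi_eq_Ioi ha,
      lintegral_union measurableSet_Ioi Set.Ioc_disjoint_Ioi_same,
      setLIntegral_congr_fun measurableSet_Ioi fun t ht =>
        expMeasure_Iio_of_nonpos (sub_nonpos.2 (le_of_lt (Set.mem_Ioi.1 ht))),
      lintegral_zero, add_zero]
    exact setLIntegral_congr_fun measurableSet_Ioc fun t ht => expMeasure_Iio hr (sub_nonneg.2 ht.2)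
  have hcont : Continuous fun t => 1 - Real.exp (-(r * (a - t))) := by fun_prop
  rw [lintegral_ofReal_sub_eq_lintegral_measure_Iio, hcut,
    ← ofReal_integral_eq_lintegral_ofReal
      (hcont.integrableOn_Icc.mono_set Set.Ioc_subset_Icc_self),
    ← intervalIntegral.integral_of_le ha,
    intervalIntegral.integral_eq_sub_of_hasDerivAt
      (f := fun t => t - Real.exp (-(r * (a - t))) / r) (fun t _ => ?_)
      (hcont.intervalIntegrable _ _)]
  · congr 1
    simp
    ring
  · have h : HasDerivAt (fun t => -(r * (a - t))) r t := by
      exact (((hasDerivAt_id t).const_sub a).const_mul r).neg.congr_deriv (by ring)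
    exact ((hasDerivAt_id t).sub (h.exp.div_const r)).congr_deriv (by field_simp)
  · refine (ae_restrict_iff' measurableSet_Ioc).2 (.of_forall fun t ht => sub_nonneg.2 ?_)
    exact Real.exp_le_one_iff.2 (neg_nonpos.2 (mul_nonneg hr.le (sub_nonneg.2 ht.2)))

lemma expMeasure_Iio_add_lintegral_sub {r : ℝ} (hr : 0 < r) (a : ℝ) :
    expMeasure r (Set.Iio a) + ENNReal.ofReal r * ∫⁻ v, ENNReal.ofReal (a - v) ∂(expMeasure r) =
      ENNReal.ofReal (r * a) := by
  rcases le_total a 0 with ha | ha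
  · have h : ∫⁻ v, ENNReal.ofReal (a - v) ∂(expMeasure r) = 0 := by
      rw [lintegral_ofReal_sub_eq_lintegral_measure_Iio, setLIntegral_congr_fun measurableSet_Ioi
        fun t ht => expMeasure_Iio_of_nonpos (by linarith [Set.mem_Ioi.1 ht]), lintegral_zero]
    rw [expMeasure_Iio_of_nonpos ha, h,
      ENNReal.ofReal_of_nonpos (mul_nonpos_of_nonneg_of_nonpos hr.le ha)]
    simp
  have hexp : Real.exp (-(r * a)) ≤ 1 := Real.exp_le_one_iff.2 (neg_nonpos.2 (mul_nonneg hr.le ha))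
  have hle : 1 - Real.exp (-(r * a)) ≤ r * a := by linarith [Real.add_one_le_exp (-(r * a))]
  rw [expMeasure_Iio hr ha, lintegral_sub_expMeasure hr ha, ← ENNReal.ofReal_mul hr.le,
    ← ENNReal.ofReal_add (sub_nonneg.2 hexp)]
  · congr 1
    field_simp
    ring
  · rw [mul_sub, mul_div_cancel₀ _ hr.ne']
    linarith

variable {Ω : Type*} [MeasurableSpace Ω] {P : Measure Ω} {V : ℕ → Ω → ℝ} {r : ℝ}

/-- The arrival times `Γ_i = V_0 + ... + V_i` with interarrival times `V`. -/
def arrivalTime (V : ℕ → Ω → ℝ) (i : ℕ) (ω : Ω) : ℝ := ∑ k ∈ Finset.range (i + 1), V k ω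

lemma measurable_arrivalTime (hm : ∀ k, Measurable (V k)) (i : ℕ) : Measurable (arrivalTime V i) :=
  Finset.measurable_sum _ fun k _ => hm k

/-- Wald's identity for `n` arrivals, with `E (w - Γ_{n-1})⁺` as the part of `w` not yet used up. -/
lemma sum_measure_arrivalTime_lt_add_le [IsProbabilityMeasure P] (hr : 0 < r)
    (hm : ∀ k, Measurable (V k)) (hl : ∀ k, P.map (V k) = expMeasure r) (hi : iIndepFun V P)
    (w : ℝ) (n : ℕ) :
    ∑ i ∈ Finset.range n, P {ω | arrivalTime V i ω < w} +
      ENNReal.ofReal r * ∫⁻ ω, ENNReal.ofReal (w - ∑ k ∈ Finset.range n, V k ω) ∂P ≤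
      ENNReal.ofReal (r * w) := by
  have hS (n) : Measurable fun ω => ∑ k ∈ Finset.range n, V k ω :=
    Finset.measurable_sum _ fun k _ => hm k
  have := isProbabilityMeasure_expMeasure hr
  induction n with
  | zero => simp [ENNReal.ofReal_mul hr.le]
  | succ n ih =>
    refine le_of_eq_of_le ?_ ih
    rw [Finset.sum_range_succ, add_assoc]
    congr 1
    have hind : IndepFun (fun ω => ∑ k ∈ Finset.range n, V k ω) (V n) P := by
      simpa only [Finset.sum_fn] using
        hi.indepFun_finsetSum_of_notMem hm (s := Finset.range n) (i := n) (by simp)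
    have hlaw := (indepFun_iff_map_prod_eq_prod_map_map (hS n).aemeasurable
      (hm n).aemeasurable).1 hind
    rw [hl n] at hlaw
    have hprob : P {ω | arrivalTime V n ω < w} =
        ∫⁻ s, expMeasure r (Set.Iio (w - s)) ∂(P.map fun ω => ∑ k ∈ Finset.range n, V k ω) := by
      have hE : MeasurableSet {p : ℝ × ℝ | p.1 + p.2 < w} :=
        measurableSet_lt (measurable_fst.add measurable_snd) measurable_const
      have h := Measure.map_apply ((hS n).prodMk (hm n)) hE (μ := P)
      rw [hlaw, Measure.prod_apply hE] at h
      simp only [arrivalTime, Finset.sum_range_succ]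
      refine h.symm.trans (lintegral_congr fun s => congrArg _ (Set.ext fun v => ?_))
      exact (lt_sub_iff_add_lt' (a := s) (b := v)).symm
    have hmean : ∫⁻ ω, ENNReal.ofReal (w - ∑ k ∈ Finset.range (n + 1), V k ω) ∂P =
        ∫⁻ s, ∫⁻ v, ENNReal.ofReal (w - s - v) ∂(expMeasure r)
          ∂(P.map fun ω => ∑ k ∈ Finset.range n, V k ω) := by
      rw [← lintegral_prod (fun p : ℝ × ℝ => ENNReal.ofReal (w - p.1 - p.2)) (by fun_prop), ← hlaw,
        lintegral_map (by fun_prop) ((hS n).prodMk (hm n))]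
      simp only [Finset.sum_range_succ, sub_sub]
    have hanti : Antitone fun s => expMeasure r (Set.Iio (w - s)) := fun _ _ h =>
      measure_mono (Set.Iio_subset_Iio (sub_le_sub_left h w))
    rw [hprob, hmean, ← lintegral_const_mul _ (by fun_prop), ← lintegral_add_left hanti.measurable,
      lintegral_congr fun s => expMeasure_Iio_add_lintegral_sub hr (w - s),
      lintegral_map (by fun_prop) (hS n), ← lintegral_const_mul _ (by fun_prop)]
    exact lintegral_congr fun ω => ENNReal.ofReal_mul hr.le

lemma tsum_measure_arrivalTime_lt_le [IsProbabilityMeasure P] (hr : 0 < r)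
    (hm : ∀ k, Measurable (V k)) (hl : ∀ k, P.map (V k) = expMeasure r) (hi : iIndepFun V P)
    (w : ℝ) : ∑' i, P {ω | arrivalTime V i ω < w} ≤ ENNReal.ofReal (r * w) := by
  rw [ENNReal.tsum_eq_iSup_nat]
  exact iSup_le fun n => le_self_add.trans (sum_measure_arrivalTime_lt_add_le hr hm hl hi w n)

end Renewal

section MaxStable

variable {d : ℕ}

/-- The largest ratio `f t / y` over the pairs `(t, y)` in `F`, and `0` if all are negative. -/
def maxRatio (F : Finset ((Fin d → ℝ) × Set.Ioi (0 : ℝ))) (f : (Fin d → ℝ) → ℝ) : ℝ≥0 :=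
  F.sup fun p => (f p.1 / p.2).toNNReal

lemma measurable_maxRatio (F : Finset ((Fin d → ℝ) × Set.Ioi (0 : ℝ))) :
    Measurable (maxRatio F) := by
  classical
  induction F using Finset.induction_on with
  | empty => exact measurable_const
  | insert p F _ ih =>
    unfold maxRatio
    simp only [Finset.sup_insert]
    refine Measurable.sup ?_ ih
    fun_prop

lemma lt_maxRatio_iff {F : Finset ((Fin d → ℝ) × Set.Ioi (0 : ℝ))} {f : (Fin d → ℝ) → ℝ} {s : ℝ}
    (hs : 0 ≤ s) : s < maxRatio F f ↔ ∃ p ∈ F, s * p.2 < f p.1 := by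
  lift s to ℝ≥0 using hs
  rw [NNReal.coe_lt_coe, maxRatio, Finset.lt_sup_iff]
  refine exists_congr fun p => and_congr_right fun _ => ?_
  rw [Real.lt_toNNReal_iff_coe_lt, lt_div_iff₀ p.2.2]

lemma tendsto_mul_one_sub_exp_neg_div (g : ℝ) :
    Tendsto (fun x : ℝ => x * (1 - Real.exp (-(g / x)))) atTop (𝓝 g) := by
  have hderiv : HasDerivAt (fun y : ℝ => -Real.exp (-(g * y))) g 0 := by
    have h := ((hasDerivAt_id (0 : ℝ)).const_mul g).neg.exp.neg
    exact h.congr_deriv (by simp)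
  refine ((hderiv.tendsto_slope_zero.mono_left
    (nhdsWithin_mono 0 fun _ h => (Set.mem_Ioi.1 h).ne')).comp tendsto_inv_atTop_nhdsGT_zero).congr
    fun x => ?_
  simp [div_eq_mul_inv, sub_eq_neg_add, add_comm]

lemma ae_pos_expMeasure {r : ℝ} : ∀ᵐ v ∂(expMeasure r), 0 < v := by
  rw [ae_iff, show {v : ℝ | ¬ 0 < v} = Set.Iic 0 by ext; simp]
  rw [show expMeasure r = volume.withDensity (exponentialPDF r) from rfl,
    withDensity_apply _ measurableSet_Iic, setLIntegral_congr Iio_ae_eq_Iic.symm]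
  exact lintegral_exponentialPDF_of_nonpos le_rfl

variable {Ω Ω' : Type*} [MeasurableSpace Ω] [MeasurableSpace Ω'] {P : Measure Ω}
  {P' : Measure Ω'} {Z : (Fin d → ℝ) → Ω → ℝ} {V : ℕ → Ω' → ℝ} {Zs : ℕ → (Fin d → ℝ) → Ω' → ℝ}

namespace IsDeHaanFamily

lemma ae_arrivalTime_pos (hV : IsDeHaanFamily P Z P' V Zs) :
    ∀ᵐ ω ∂P', ∀ i, 0 < arrivalTime V i ω := by
  have hpos (k) : ∀ᵐ ω ∂P', 0 < V k ω :=
    ae_of_ae_map (hV.measurable_exp k).aemeasurable (hV.law_exp k ▸ ae_pos_expMeasure)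
  filter_upwards [ae_all_iff.2 hpos] with ω hω i
  exact Finset.sum_pos (fun k _ => hω k) Finset.nonempty_range_add_one

section Functional

variable [IsProbabilityMeasure P'] {φ : ((Fin d → ℝ) → ℝ) → ℝ≥0}

lemma measure_mul_arrivalTime_lt (hV : IsDeHaanFamily P Z P' V Zs) (hZ : ∀ t, Measurable (Z t))
    (hφ : Measurable φ) (x : ℝ) (i : ℕ) :
    P' {ω | x * arrivalTime V i ω < φ fun t => Zs i t ω} =
      ∫⁻ ω, P' {ω' | x * arrivalTime V i ω' < φ fun t => Z t ω} ∂P := by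
  have hΓ := measurable_arrivalTime hV.measurable_exp i
  have hZi : Measurable fun ω t => Zs i t ω := measurable_pi_iff.2 (hV.measurable_copy i)
  have hind : IndepFun (fun ω t => Zs i t ω) (arrivalTime V i) P' :=
    (hV.indep.comp (φ := fun v : ℕ → ℝ => ∑ k ∈ Finset.range (i + 1), v k)
      (ψ := fun z : ℕ → (Fin d → ℝ) → ℝ => z i) (by fun_prop) (by fun_prop)).symm
  have hlaw := (indepFun_iff_map_prod_eq_prod_map_map hZi.aemeasurable hΓ.aemeasurable).1 hind
  have hA : MeasurableSet {p : ((Fin d → ℝ) → ℝ) × ℝ | x * p.2 < φ p.1} :=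
    measurableSet_lt (by fun_prop) (hφ.comp measurable_fst).coe_nnreal_real
  have h := Measure.map_apply (hZi.prodMk hΓ) hA (μ := P')
  have := Measure.isProbabilityMeasure_map hΓ.aemeasurable (μ := P')
  rw [hlaw, hV.law_copy i, Measure.prod_apply hA,
    lintegral_map (measurable_measure_prodMk_left hA) (measurable_pi_iff.2 hZ)] at h
  refine h.symm.trans (lintegral_congr fun ω => ?_)
  exact Measure.map_apply hΓ (measurable_prodMk_left hA)

lemma mul_measure_exists_lt_le (hV : IsDeHaanFamily P Z P' V Zs) (hZ : ∀ t, Measurable (Z t))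
    (hφ : Measurable φ) {x : ℝ} (hx : 0 < x) :
    ENNReal.ofReal x * P' {ω | ∃ i, x * arrivalTime V i ω < φ fun t => Zs i t ω} ≤
      ∫⁻ ω, φ (fun t => Z t ω) ∂P := by
  have hφZ : Measurable fun ω => φ fun t => Z t ω := hφ.comp (measurable_pi_iff.2 hZ)
  have hm (i) : Measurable fun ω => P' {ω' | x * arrivalTime V i ω' < φ fun t => Z t ω} :=
    measurable_measure_prodMk_left
      (s := {p : Ω × Ω' | x * arrivalTime V i p.2 < φ fun t => Z t p.1}) (measurableSet_lt
        (((measurable_arrivalTime hV.measurable_exp i).comp measurable_snd).const_mul x)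
        (hφZ.comp measurable_fst).coe_nnreal_real)
  have hrenewal (g : ℝ≥0) :
      ENNReal.ofReal x * ∑' i, P' {ω | x * arrivalTime V i ω < g} ≤ g := by
    have h := tsum_measure_arrivalTime_lt_le one_pos hV.measurable_exp hV.law_exp hV.indep_exp
      (g / x)
    simp only [lt_div_iff₀' hx, one_mul] at h
    refine (mul_le_mul_right h _).trans_eq ?_
    rw [← ENNReal.ofReal_mul hx.le, mul_div_cancel₀ _ hx.ne', ENNReal.ofReal_coe_nnreal]
  calc ENNReal.ofReal x * P' {ω | ∃ i, x * arrivalTime V i ω < φ fun t => Zs i t ω}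
    _ ≤ ENNReal.ofReal x * ∑' i, P' {ω | x * arrivalTime V i ω < φ fun t => Zs i t ω} := by
        rw [Set.ofPred_exists]
        gcongr
        exact measure_iUnion_le _
    _ = ∫⁻ ω, ENNReal.ofReal x *
          ∑' i, P' {ω' | x * arrivalTime V i ω' < φ fun t => Z t ω} ∂P := by
        simp_rw [hV.measure_mul_arrivalTime_lt hZ hφ x]
        rw [← lintegral_tsum fun i => (hm i).aemeasurable,
          lintegral_const_mul _ (Measurable.tsum hm)]
    _ ≤ ∫⁻ ω, φ (fun t => Z t ω) ∂P := lintegral_mono fun ω => hrenewal _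

lemma le_mul_measure_exists_lt (hV : IsDeHaanFamily P Z P' V Zs) (hZ : ∀ t, Measurable (Z t))
    (hφ : Measurable φ) {x : ℝ} (hx : 0 < x) :
    ∫⁻ ω, ENNReal.ofReal (x * (1 - Real.exp (-(φ (fun t => Z t ω) / x)))) ∂P ≤
      ENNReal.ofReal x * P' {ω | ∃ i, x * arrivalTime V i ω < φ fun t => Zs i t ω} := by
  have hfirst (g : ℝ≥0) :
      P' {ω | x * arrivalTime V 0 ω < g} = ENNReal.ofReal (1 - Real.exp (-(g / x))) := by
    have h := expMeasure_Iio one_pos (div_nonneg g.2 hx.le)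
    rw [← hV.law_exp 0, Measure.map_apply (hV.measurable_exp 0) measurableSet_Iio, one_mul] at h
    rw [← NNReal.val_eq_coe, ← h]
    simp [arrivalTime, lt_div_iff₀' hx, Set.preimage]
  calc ∫⁻ ω, ENNReal.ofReal (x * (1 - Real.exp (-(φ (fun t => Z t ω) / x)))) ∂P
    _ = ENNReal.ofReal x * P' {ω | x * arrivalTime V 0 ω < φ fun t => Zs 0 t ω} := by
        rw [hV.measure_mul_arrivalTime_lt hZ hφ, ← lintegral_const_mul' _ _ ENNReal.ofReal_ne_top]
        simp_rw [hfirst, ENNReal.ofReal_mul hx.le]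
    _ ≤ ENNReal.ofReal x * P' {ω | ∃ i, x * arrivalTime V i ω < φ fun t => Zs i t ω} := by
        gcongr
        exact fun hω => ⟨0, hω⟩

/-- For large `x` an exceedance is due to a single point of the Poisson process. -/
lemma tendsto_mul_measure_exists_lt (hV : IsDeHaanFamily P Z P' V Zs)
    (hZ : ∀ t, Measurable (Z t)) (hφ : Measurable φ) :
    Tendsto (fun x : ℝ => ENNReal.ofReal x *
      P' {ω | ∃ i, x * arrivalTime V i ω < φ fun t => Zs i t ω}) atTop
      (𝓝 (∫⁻ ω, φ (fun t => Z t ω) ∂P)) := by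
  have : Measurable fun ω => φ fun t => Z t ω := hφ.comp (measurable_pi_iff.2 hZ)
  refine tendsto_of_le_liminf_of_limsup_le ?_ ?_
  · have hlim (ω) : liminf (fun x : ℝ => ENNReal.ofReal
        (x * (1 - Real.exp (-(φ (fun t => Z t ω) / x))))) atTop = φ fun t => Z t ω := by
      rw [← ENNReal.ofReal_coe_nnreal]
      exact (ENNReal.tendsto_ofReal (tendsto_mul_one_sub_exp_neg_div _)).liminf_eq
    simp_rw [← hlim]
    refine (lintegral_liminf_le fun x => by fun_prop).trans (liminf_le_liminf ?_)
    filter_upwards [eventually_gt_atTop 0] with x hx using hV.le_mul_measure_exists_lt hZ hφ hx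
  · refine limsup_le_of_le (h := ?_)
    filter_upwards [eventually_gt_atTop 0] with x hx using hV.mul_measure_exists_lt_le hZ hφ hx

end Functional

lemma exists_lt_maxStableField_ae_eq (hV : IsDeHaanFamily P Z P' V Zs)
    (F : Finset ((Fin d → ℝ) × Set.Ioi (0 : ℝ))) (h : Fin d → ℝ) {x : ℝ} (hx : 0 < x) :
    {ω | ∃ p ∈ F, ENNReal.ofReal (x * p.2) < maxStableField V Zs (p.1 + h) ω} =ᵐ[P']
      {ω | ∃ i, x * arrivalTime V i ω < maxRatio F fun t => Zs i (t + h) ω} := by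
  filter_upwards [hV.ae_arrivalTime_pos] with ω hω
  have hlevel (p : (Fin d → ℝ) × Set.Ioi (0 : ℝ)) (i : ℕ) :
      ENNReal.ofReal (x * p.2) < ENNReal.ofReal ((arrivalTime V i ω)⁻¹ * Zs i (p.1 + h) ω) ↔
        x * arrivalTime V i ω * p.2 < Zs i (p.1 + h) ω := by
    rw [ENNReal.ofReal_lt_ofReal_iff_of_nonneg (mul_pos hx p.2.2).le, inv_mul_eq_div,
      lt_div_iff₀ (hω i), mul_right_comm]
  have hiff : (∃ p ∈ F, ENNReal.ofReal (x * p.2) < maxStableField V Zs (p.1 + h) ω) ↔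
      ∃ i, x * arrivalTime V i ω < maxRatio F fun t => Zs i (t + h) ω := by
    simp_rw [lt_maxRatio_iff (mul_pos hx (hω _)).le, ← hlevel, maxStableField, lt_iSup_iff,
      arrivalTime]
    exact ⟨fun ⟨p, hp, i, hi⟩ => ⟨i, p, hp, hi⟩, fun ⟨i, p, hp, hi⟩ => ⟨p, hp, i, hi⟩⟩
  exact propext hiff

end IsDeHaanFamily

lemma IsStationary.measure_exists_lt {X : (Fin d → ℝ) → Ω → ℝ≥0∞} (hX : IsStationary P X)
    (F : Finset ((Fin d → ℝ) × Set.Ioi (0 : ℝ))) (h : Fin d → ℝ) (x : ℝ) :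
    P {ω | ∃ p ∈ F, ENNReal.ofReal (x * p.2) < X (p.1 + h) ω} =
      P {ω | ∃ p ∈ F, ENNReal.ofReal (x * p.2) < X p.1 ω} := by
  have hm : MeasurableSet (⋃ p ∈ F, {g : (Fin d → ℝ) → ℝ≥0∞ | ENNReal.ofReal (x * p.2) < g p.1}) :=
    F.measurableSet_biUnion fun p _ => measurableSet_lt measurable_const (measurable_pi_apply _)
  rw [show (⋃ p ∈ F, {g : (Fin d → ℝ) → ℝ≥0∞ | ENNReal.ofReal (x * p.2) < g p.1}) =
    {g | ∃ p ∈ F, ENNReal.ofReal (x * p.2) < g p.1} by ext; simp] at hm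
  exact (hX h).measure_mem_eq hm

lemma lintegral_maxRatio_add [IsProbabilityMeasure P'] (hV : IsDeHaanFamily P Z P' V Zs)
    (hZ : ∀ t, Measurable (Z t)) (hX : IsStationary P' (maxStableField V Zs))
    (F : Finset ((Fin d → ℝ) × Set.Ioi (0 : ℝ))) (h : Fin d → ℝ) :
    ∫⁻ ω, maxRatio F (fun t => Z (t + h) ω) ∂P = ∫⁻ ω, maxRatio F (fun t => Z t ω) ∂P := by
  have hshift (h : Fin d → ℝ) : Measurable
      fun f : (Fin d → ℝ) → ℝ => maxRatio F fun t => f (t + h) :=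
    (measurable_maxRatio F).comp (measurable_pi_iff.2 fun t => measurable_pi_apply (t + h))
  have hlim (h : Fin d → ℝ) : Tendsto (fun x : ℝ => ENNReal.ofReal x *
      P' {ω | ∃ p ∈ F, ENNReal.ofReal (x * p.2) < maxStableField V Zs p.1 ω}) atTop
      (𝓝 (∫⁻ ω, maxRatio F (fun t => Z (t + h) ω) ∂P)) := by
    refine (hV.tendsto_mul_measure_exists_lt hZ (hshift h)).congr' ?_
    filter_upwards [eventually_gt_atTop 0] with x hx
    rw [← measure_congr (hV.exists_lt_maxStableField_ae_eq F h hx), hX.measure_exists_lt]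
  simpa using tendsto_nhds_unique (hlim h) (hlim 0)

end MaxStable

section MeasureUniqueness

variable {α ι : Type*} [m : MeasurableSpace α] {μ ν : Measure α} {C : Set (Set α)}

/-- Inclusion–exclusion turns a generating class closed under unions into a π-system of
complements inside each of its members. -/
lemma restrict_eq_of_supClosed_generating (hgen : m = MeasurableSpace.generateFrom C)
    (hC : SupClosed C) (hμν : ∀ A ∈ C, μ A = ν A) (hfin : ∀ A ∈ C, μ A ≠ ∞) {B : Set α}
    (hB : B ∈ C) : μ.restrict B = ν.restrict B := by
  have hmeas {A} (hA : A ∈ C) : MeasurableSet A :=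
    hgen ▸ MeasurableSpace.measurableSet_generateFrom hA
  have hpi : IsPiSystem (compl '' C) := by
    rintro _ ⟨A, hA, rfl⟩ _ ⟨A', hA', rfl⟩ -
    exact ⟨A ∪ A', hC hA hA', Set.compl_union A A'⟩
  have hgen' : m = MeasurableSpace.generateFrom (compl '' C) := by
    refine le_antisymm (hgen.trans_le (MeasurableSpace.generateFrom_le fun A hA => ?_))
      (MeasurableSpace.generateFrom_le ?_)
    · rw [← compl_compl A]
      exact (MeasurableSpace.measurableSet_generateFrom (Set.mem_image_of_mem _ hA)).compl
    · rintro _ ⟨A, hA, rfl⟩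
      exact (hmeas hA).compl
  have : IsFiniteMeasure (μ.restrict B) := ⟨by simpa using (hfin B hB).lt_top⟩
  refine ext_of_generate_finite _ hgen' hpi ?_ (by simpa using hμν B hB)
  rintro _ ⟨A, hA, rfl⟩
  have hdiff (ρ : Measure α) : ρ A + ρ.restrict B Aᶜ = ρ (A ∪ B) := by
    rw [Measure.restrict_apply (hmeas hA).compl, Set.inter_comm, ← Set.sdiff_eq,
      measure_add_sdiff (hmeas hA).nullMeasurableSet]
  refine (ENNReal.add_right_inj (hfin A hA)).1 ?_
  rw [hdiff μ, hμν A hA, hdiff ν, hμν (A ∪ B) (hC hA hB)]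

lemma measure_ext_of_supClosed_generating [Countable ι]
    (hgen : m = MeasurableSpace.generateFrom C) (hC : SupClosed C) (hμν : ∀ A ∈ C, μ A = ν A)
    (hfin : ∀ A ∈ C, μ A ≠ ∞) {B : ι → Set α} (hB : ∀ i, B i ∈ C)
    (hμB : ∀ᵐ x ∂μ, x ∈ ⋃ i, B i) (hνB : ∀ᵐ x ∂ν, x ∈ ⋃ i, B i) : μ = ν := by
  rw [← Measure.restrict_eq_self_of_ae_mem hμB, ← Measure.restrict_eq_self_of_ae_mem hνB,
    Measure.restrict_iUnion_congr]
  exact fun i => restrict_eq_of_supClosed_generating hgen hC hμν hfin (hB i)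

end MeasureUniqueness

section Exceedances

variable {d : ℕ}

/-- The paths that exceed one of the levels in `F`, a level being a point of `ℝ^d` together with a
positive height. -/
def exceedPaths (F : Finset ((Fin d → ℝ) × Set.Ioi (0 : ℝ))) : Set (Path d) :=
  {f | ∃ p ∈ F, p.2 < f.1 p.1}

lemma measurableSet_exceedPaths (F : Finset ((Fin d → ℝ) × Set.Ioi (0 : ℝ))) :
    MeasurableSet (exceedPaths F) := by
  have h : MeasurableSet (⋃ p ∈ F, {f : Path d | p.2 < f.1 p.1}) :=
    F.measurableSet_biUnion fun p _ => measurableSet_lt_eval _ _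
  rwa [show (⋃ p ∈ F, {f : Path d | p.2 < f.1 p.1}) = exceedPaths F by ext; simp [exceedPaths]] at h

lemma supClosed_range_exceedPaths : SupClosed (Set.range (exceedPaths (d := d))) := by
  classical
  rintro _ ⟨F, rfl⟩ _ ⟨G, rfl⟩
  refine ⟨F ∪ G, Set.ext fun f => ?_⟩
  simp only [exceedPaths, Finset.mem_union, Set.sup_eq_union, Set.mem_union, Set.mem_ofPred_eq,
    or_and_right, exists_or]

lemma generateFrom_range_exceedPaths :
    (Subtype.instMeasurableSpace : MeasurableSpace (Path d)) =
      MeasurableSpace.generateFrom (Set.range exceedPaths) := by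
  refine le_antisymm ?_ (MeasurableSpace.generateFrom_le ?_)
  · refine Measurable.comap_le (m₁ := .generateFrom (Set.range exceedPaths))
      (f := fun f : Path d => f.1) ?_
    refine (@measurable_pi_iff _ _ _ (.generateFrom (Set.range exceedPaths)) _ _).2 fun t => ?_
    refine @measurable_of_Ioi _ _ _ _ _ (.generateFrom (Set.range exceedPaths)) _ _ _ _ fun y => ?_
    rcases lt_or_ge y 0 with hy | hy
    · convert @MeasurableSet.univ _ (.generateFrom (Set.range exceedPaths))
      exact Set.eq_univ_of_forall fun f => hy.trans_le (f.2.1 t)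
    have hlevel (n : ℕ) : 0 < y + 1 / ((n : ℝ) + 1) :=
      add_pos_of_nonneg_of_pos hy Nat.one_div_pos_of_nat
    have hunion : (fun f : Path d => f.1 t) ⁻¹' Set.Ioi y =
        ⋃ n : ℕ, exceedPaths {(t, ⟨y + 1 / ((n : ℝ) + 1), Set.mem_Ioi.2 (hlevel n)⟩)} := by
      ext f
      simp only [Set.mem_preimage, Set.mem_Ioi, Set.mem_iUnion, exceedPaths, Finset.mem_singleton,
        exists_eq_left, Set.mem_ofPred_eq]
      refine ⟨fun hf => ?_, fun ⟨n, hn⟩ => (lt_add_of_pos_right y Nat.one_div_pos_of_nat).trans hn⟩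
      obtain ⟨n, hn⟩ := exists_nat_one_div_lt (sub_pos.2 hf)
      exact ⟨n, lt_sub_iff_add_lt'.1 hn⟩
    rw [hunion]
    exact .iUnion fun n => MeasurableSpace.measurableSet_generateFrom ⟨_, rfl⟩
  · rintro _ ⟨F, rfl⟩
    exact measurableSet_exceedPaths F

lemma exists_pos_iff_mem_iUnion_exceedPaths {f : Path d} :
    (∃ t, 0 < f.1 t) ↔ f ∈ ⋃ i : (Fin d → ℚ) × ℕ,
      exceedPaths {(fun j => (i.1 j : ℝ),
        ⟨1 / ((i.2 : ℝ) + 1), Set.mem_Ioi.2 Nat.one_div_pos_of_nat⟩)} := by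
  simp only [Set.mem_iUnion, exceedPaths, Finset.mem_singleton, exists_eq_left, Set.mem_ofPred_eq,
    Prod.exists]
  constructor
  · rintro ⟨t, ht⟩
    obtain ⟨q, hq⟩ := exists_rat_superlevel f ht
    obtain ⟨n, hn⟩ := exists_nat_one_div_lt hq
    exact ⟨q, n, hn⟩
  · rintro ⟨q, n, hn⟩
    exact ⟨_, Nat.one_div_pos_of_nat.trans hn⟩

end Exceedances

section TailMeasure

variable {d : ℕ} {Ω Ω' : Type*} [MeasurableSpace Ω] [MeasurableSpace Ω'] {P : Measure Ω}
  {P' : Measure Ω'} {X : Ω → Path d} {X' : Ω' → Path d}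

/-- The tail measure of a random path `X`: the law of `X / s` under `P(dω) ds` on `Ω × (0, ∞)`,
which is the intensity of the Poisson process `Γ_i⁻¹ X_i` of the de Haan representation. -/
def tailMeasure (P : Measure Ω) (X : Ω → Path d) : Measure (Path d) :=
  (P.prod (volume.restrict (Set.Ioi (0 : ℝ)))).map fun p => scale p.2⁻¹.toNNReal (X p.1)

/-- Invariance of a measure on path space under all shifts. -/
def ShiftInvariant (ν : Measure (Path d)) : Prop :=
  ∀ h, MeasurePreserving (shift h) ν ν

instance [SFinite P] : SFinite (tailMeasure P X) := by
  unfold tailMeasure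
  infer_instance

lemma measurable_scale_inv (hX : Measurable X) :
    Measurable fun p : Ω × ℝ => scale p.2⁻¹.toNNReal (X p.1) :=
  measurable_uncurry_scale.comp (measurable_snd.inv.real_toNNReal.prodMk (hX.comp measurable_fst))

lemma tailMeasure_apply (hX : Measurable X) {A : Set (Path d)} (hA : MeasurableSet A) :
    tailMeasure P X A =
      ∫⁻ ω, volume {s : ℝ | 0 < s ∧ scale s⁻¹.toNNReal (X ω) ∈ A} ∂P := by
  rw [tailMeasure, Measure.map_apply (measurable_scale_inv hX) hA,
    Measure.prod_apply (measurable_scale_inv hX hA)]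
  refine lintegral_congr fun ω => ?_
  rw [Measure.restrict_apply' measurableSet_Ioi, Set.inter_comm]
  rfl

lemma ae_tailMeasure_of_forall_scale (hX : Measurable X) {p : Path d → Prop}
    (hp : MeasurableSet {f | p f}) (h : ∀ᵐ ω ∂P, ∀ s : ℝ, 0 < s → p (scale s⁻¹.toNNReal (X ω))) :
    ∀ᵐ f ∂(tailMeasure P X), p f := by
  rw [tailMeasure, ae_map_iff (measurable_scale_inv hX).aemeasurable hp]
  refine (Measure.ae_prod_iff_ae_ae (p := fun q : Ω × ℝ => p (scale q.2⁻¹.toNNReal (X q.1)))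
    (measurable_scale_inv hX hp)).2 ?_
  filter_upwards [h] with ω hω
  exact (ae_restrict_iff' measurableSet_Ioi).2 (.of_forall hω)

lemma map_shift_tailMeasure (hX : Measurable X) (h : Fin d → ℝ) :
    (tailMeasure P X).map (shift h) = tailMeasure P fun ω => shift h (X ω) := by
  rw [tailMeasure, Measure.map_map (measurable_shift h) (measurable_scale_inv hX)]
  rfl

lemma tailMeasure_exceedPaths (hX : Measurable X)
    (F : Finset ((Fin d → ℝ) × Set.Ioi (0 : ℝ))) :
    tailMeasure P X (exceedPaths F) = ∫⁻ ω, maxRatio F (X ω).1 ∂P := by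
  rw [tailMeasure_apply hX (measurableSet_exceedPaths F)]
  refine lintegral_congr fun ω => ?_
  have hinterval : {s : ℝ | 0 < s ∧ scale s⁻¹.toNNReal (X ω) ∈ exceedPaths F} =
      Set.Ioo 0 (maxRatio F (X ω).1 : ℝ) := by
    ext s
    refine and_congr_right fun hs => ?_
    rw [lt_maxRatio_iff hs.le]
    refine exists_congr fun p => and_congr_right fun _ => ?_
    rw [scale_inv_toNNReal_apply hs.le, lt_div_iff₀ hs, mul_comm]
  rw [hinterval, Real.volume_Ioo, sub_zero, ENNReal.ofReal_coe_nnreal]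

lemma lintegral_maxRatio_lt_top (hX : Measurable X)
    (hfin : ∀ t, ∫⁻ ω, ENNReal.ofReal ((X ω).1 t) ∂P < ∞)
    (F : Finset ((Fin d → ℝ) × Set.Ioi (0 : ℝ))) : ∫⁻ ω, maxRatio F (X ω).1 ∂P < ∞ := by
  have hm (t) : Measurable fun ω => (X ω).1 t := (measurable_eval t).comp hX
  have hsum (f : Path d) : (maxRatio F f.1 : ℝ≥0∞) ≤ ∑ p ∈ F, ENNReal.ofReal (f.1 p.1 / p.2) := by
    simp only [ENNReal.ofReal, ← ENNReal.ofNNReal_finsetSum, ENNReal.coe_le_coe]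
    exact Finset.sup_le fun p hp =>
      Finset.single_le_sum (f := fun p : (Fin d → ℝ) × Set.Ioi (0 : ℝ) => (f.1 p.1 / p.2).toNNReal)
        (fun _ _ => zero_le) hp
  refine (lintegral_mono fun ω => hsum (X ω)).trans_lt ?_
  rw [lintegral_finsetSum _ fun p _ => ((hm _).div_const _).ennreal_ofReal]
  refine ENNReal.sum_lt_top.2 fun p _ => ?_
  simp_rw [ENNReal.ofReal_div_of_pos p.2.2, div_eq_mul_inv]
  rw [lintegral_mul_const _ (hm _).ennreal_ofReal]
  exact ENNReal.mul_lt_top (hfin _) (ENNReal.inv_lt_top.2 (ENNReal.ofReal_pos.2 p.2.2))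

lemma ae_tailMeasure_exists_pos (hX : Measurable X) (hpos : ∀ᵐ ω ∂P, ∃ t, 0 < (X ω).1 t) :
    ∀ᵐ f ∂(tailMeasure P X), ∃ t, 0 < f.1 t := by
  refine ae_tailMeasure_of_forall_scale hX ?_ ?_
  · simp_rw [exists_pos_iff_mem_iUnion_exceedPaths, Set.ofPred_mem_eq]
    exact .iUnion fun i => measurableSet_exceedPaths _
  · filter_upwards [hpos] with ω ⟨t, ht⟩ s hs
    exact ⟨t, by rw [scale_inv_toNNReal_apply hs.le]; exact div_pos ht hs⟩

lemma tailMeasure_congr (hX : Measurable X) (hX' : Measurable X')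
    (hfin : ∀ t, ∫⁻ ω, ENNReal.ofReal ((X ω).1 t) ∂P < ∞)
    (hpos : ∀ᵐ ω ∂P, ∃ t, 0 < (X ω).1 t) (hpos' : ∀ᵐ ω ∂P', ∃ t, 0 < (X' ω).1 t)
    (h : ∀ F : Finset ((Fin d → ℝ) × Set.Ioi (0 : ℝ)),
      ∫⁻ ω, maxRatio F (X ω).1 ∂P = ∫⁻ ω, maxRatio F (X' ω).1 ∂P') :
    tailMeasure P X = tailMeasure P' X' := by
  have hae := ae_tailMeasure_exists_pos hX hpos
  have hae' := ae_tailMeasure_exists_pos hX' hpos'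
  simp_rw [exists_pos_iff_mem_iUnion_exceedPaths] at hae hae'
  refine measure_ext_of_supClosed_generating generateFrom_range_exceedPaths
    supClosed_range_exceedPaths ?_ ?_ (fun i => ⟨_, rfl⟩) hae hae'
  · rintro _ ⟨F, rfl⟩
    rw [tailMeasure_exceedPaths hX, tailMeasure_exceedPaths hX', h F]
  · rintro _ ⟨F, rfl⟩
    rw [tailMeasure_exceedPaths hX]
    exact (lintegral_maxRatio_lt_top hX hfin F).ne

lemma IsSpectralField.lintegral_eq_one {Z : (Fin d → ℝ) → Ω → ℝ} (hZ : IsSpectralField P Z)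
    (t : Fin d → ℝ) : ∫⁻ ω, ENNReal.ofReal (Z t ω) ∂P = 1 := by
  have hint : Integrable (Z t) P := by
    by_contra h
    exact zero_ne_one ((integral_undef h).symm.trans (hZ.mean_one t))
  rw [← ofReal_integral_eq_lintegral_ofReal hint, hZ.mean_one t, ENNReal.ofReal_one]
  filter_upwards [hZ.paths] with ω hω using hω.1 t

lemma shiftInvariant_tailMeasure [IsProbabilityMeasure P'] {Z : (Fin d → ℝ) → Ω → ℝ}
    (hZ : IsSpectralField P Z) (hX : Measurable X) (hXZ : ∀ᵐ ω ∂P, (X ω).1 = fun t => Z t ω)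
    {V : ℕ → Ω' → ℝ} {Zs : ℕ → (Fin d → ℝ) → Ω' → ℝ} (hV : IsDeHaanFamily P Z P' V Zs)
    (hst : IsStationary P' (maxStableField V Zs)) : ShiftInvariant (tailMeasure P X) := by
  have hpos : ∀ᵐ ω ∂P, ∃ t, 0 < (X ω).1 t := by
    filter_upwards [hZ.sup_pos, hXZ] with ω hω h
    rwa [h]
  refine fun h => ⟨measurable_shift h, ?_⟩
  rw [map_shift_tailMeasure hX]
  refine (tailMeasure_congr hX ((measurable_shift h).comp hX) (fun t => ?_) hpos ?_
    fun F => ?_).symm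
  · refine lt_of_eq_of_lt (lintegral_congr_ae ?_)
      ((hZ.lintegral_eq_one t).trans_lt ENNReal.one_lt_top)
    filter_upwards [hXZ] with ω hω
    rw [hω]
  · filter_upwards [hpos] with ω ⟨t, ht⟩
    exact ⟨t - h, by simpa [shift] using ht⟩
  · have hF := lintegral_maxRatio_add hV hZ.measurable hst F h
    have hmodification (h) : ∫⁻ ω, maxRatio F (fun t => (X ω).1 (t + h)) ∂P =
        ∫⁻ ω, maxRatio F (fun t => Z (t + h) ω) ∂P := by
      refine lintegral_congr_ae ?_
      filter_upwards [hXZ] with ω hω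
      rw [hω]
    have hzero := hmodification 0
    simp only [add_zero] at hzero
    exact ((hmodification h).trans (hF.trans hzero.symm)).symm

end TailMeasure

section Pareto

lemma paretoMeasure_Ici {t r x : ℝ} (ht : 0 < t) (hr : 0 < r) (hx : t ≤ x) :
    paretoMeasure t r (Set.Ici x) = ENNReal.ofReal ((t / x) ^ r) := by
  have hx0 : 0 < x := ht.trans_le hx
  have hexp : -(r + 1) < -1 := by linarith
  have hpdf : Set.EqOn (paretoPDF t r)
      (fun y => ENNReal.ofReal (r * t ^ r * y ^ (-(r + 1)))) (Set.Ioi x) :=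
    fun y hy => paretoPDF_of_le (hx.trans (Set.mem_Ioi.1 hy).le)
  have hnonneg : ∀ᵐ y ∂(volume.restrict (Set.Ioi x)), 0 ≤ r * t ^ r * y ^ (-(r + 1)) := by
    filter_upwards [ae_restrict_mem measurableSet_Ioi] with y hy
    have : 0 < y := hx0.trans hy
    positivity
  rw [paretoMeasure, withDensity_apply _ measurableSet_Ici, ← setLIntegral_congr Ioi_ae_eq_Ici,
    setLIntegral_congr_fun measurableSet_Ioi hpdf, ← ofReal_integral_eq_lintegral_ofReal
      ((integrableOn_Ioi_rpow_of_lt hexp hx0).const_mul _) hnonneg,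
    integral_const_mul, integral_Ioi_rpow_of_lt hexp hx0, Real.div_rpow ht.le hx0.le,
    show -(r + 1) + 1 = -r by ring, Real.rpow_neg hx0.le]
  congr 1
  field_simp

lemma ae_le_paretoMeasure (t r : ℝ) : ∀ᵐ x ∂(paretoMeasure t r), t ≤ x := by
  rw [ae_iff, show {x : ℝ | ¬ t ≤ x} = Set.Iio t by ext; simp, paretoMeasure,
    withDensity_apply _ measurableSet_Iio, lintegral_paretoPDF_of_le le_rfl]

lemma paretoMeasure_Ici_eq_max {t r : ℝ} (ht : 0 < t) (hr : 0 < r) (x : ℝ) :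
    paretoMeasure t r (Set.Ici x) = ENNReal.ofReal ((t / max t x) ^ r) := by
  rw [← paretoMeasure_Ici ht hr (le_max_left t x)]
  refine measure_congr (eventuallyEq_set.2 ?_)
  filter_upwards [ae_le_paretoMeasure t r] with y hy
  simp [hy]

lemma map_div_volume_Ioo {c : ℝ} (hc : 0 < c) :
    (volume.restrict (Set.Ioo 0 c)).map (c / ·) = ENNReal.ofReal c • paretoMeasure 1 1 := by
  have : IsProbabilityMeasure (paretoMeasure 1 1) :=
    isProbabilityMeasure_paretoMeasure one_pos one_pos
  have : IsFiniteMeasure ((volume.restrict (Set.Ioo 0 c)).map (c / ·)) :=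
    Measure.isFiniteMeasure_map _ _
  refine Measure.ext_of_Ici _ _ fun x => ?_
  have hm : (0 : ℝ) < max 1 x := one_pos.trans_le (le_max_left 1 x)
  have hpre : Set.Ioc 0 c ∩ (c / ·) ⁻¹' Set.Ici x = Set.Ioc 0 (c / max 1 x) := by
    ext s
    simp only [Set.mem_inter_iff, Set.mem_Ioc, Set.mem_preimage, Set.mem_Ici, and_assoc]
    refine and_congr_right fun hs => ?_
    rw [le_div_comm₀ hs hm, max_le_iff, one_le_div hs]
  rw [Measure.map_apply (by fun_prop) measurableSet_Ici,
    Measure.restrict_congr_set Ioo_ae_eq_Ioc, Measure.restrict_apply' measurableSet_Ioc,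
    Set.inter_comm, hpre, Real.volume_Ioc, Measure.smul_apply,
    paretoMeasure_Ici_eq_max one_pos one_pos, Real.rpow_one, smul_eq_mul,
    ← ENNReal.ofReal_mul hc.le, sub_zero, mul_one_div]

lemma ofReal_mul_paretoMeasure {c : ℝ} (hc : 0 ≤ c) {B : Set ℝ} (hB : MeasurableSet B) :
    ENNReal.ofReal c * paretoMeasure 1 1 B = volume (Set.Ioo 0 c ∩ {s | c / s ∈ B}) := by
  rcases hc.eq_or_lt with rfl | hc
  · simp
  · rw [← smul_eq_mul, ← Measure.smul_apply, ← map_div_volume_Ioo hc,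
      Measure.map_apply (by fun_prop) hB, Measure.restrict_apply' measurableSet_Ioo,
      Set.inter_comm]
    rfl

end Pareto

section Tilted

variable {d : ℕ} {Ω Ω₂ : Type*} [MeasurableSpace Ω] [MeasurableSpace Ω₂] {P : Measure Ω}
  {P₂ : Measure Ω₂} {Z : (Fin d → ℝ) → Ω → ℝ} {Θ : (Fin d → ℝ) → Ω₂ → ℝ} {R : Ω₂ → ℝ}

lemma tailMeasure_inter_one_lt {X : Ω → Path d} (hX : Measurable X)
    {B : Set ((Fin d → ℝ) → ℝ)} (hB : MeasurableSet B) :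
    tailMeasure P X (Subtype.val ⁻¹' B ∩ {f | 1 < f.1 0}) = ∫⁻ ω, ENNReal.ofReal ((X ω).1 0) *
      paretoMeasure 1 1 {r | (fun t => r * ((X ω).1 t / (X ω).1 0)) ∈ B} ∂P := by
  have hm : MeasurableSet {f : Path d | 1 < f.1 0} := measurableSet_lt_eval 1 0
  rw [tailMeasure_apply hX ((measurable_subtype_coe hB).inter hm)]
  refine lintegral_congr fun ω => ?_
  have hBm : MeasurableSet {r : ℝ | (fun t => r * ((X ω).1 t / (X ω).1 0)) ∈ B} :=
    (measurable_pi_iff.2 fun t => measurable_id.mul_const _) hB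
  rw [ofReal_mul_paretoMeasure ((X ω).2.1 0) hBm]
  congr 1
  ext s
  simp only [Set.mem_inter_iff, Set.mem_preimage, Set.mem_ofPred_eq, Set.mem_Ioo, and_assoc]
  refine and_congr_right fun hs => ?_
  rw [funext (scale_inv_toNNReal_apply hs.le (X ω)), one_lt_div hs, and_comm]
  refine and_congr_right fun hX0 => ?_
  have hratio (t) : (X ω).1 0 / s * ((X ω).1 t / (X ω).1 0) = (X ω).1 t / s := by
    have := (hs.trans hX0).ne'
    field_simp
  simp_rw [hratio]

lemma IsTilted.measure_mul_mem [SFinite P] [IsFiniteMeasure P₂] (hΘ : IsTilted P Z P₂ Θ)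
    (hZ : ∀ t, Measurable (Z t)) (hRm : Measurable R) (hR : P₂.map R = paretoMeasure 1 1)
    (hRΘ : IndepFun R (fun ω t => Θ t ω) P₂) {B : Set ((Fin d → ℝ) → ℝ)} (hB : MeasurableSet B) :
    P₂ {ω | (fun t => R ω * Θ t ω) ∈ B} = ∫⁻ ω, ENNReal.ofReal (Z 0 ω) *
      paretoMeasure 1 1 {r | (fun t => r * (Z t ω / Z 0 ω)) ∈ B} ∂P := by
  have : IsProbabilityMeasure (paretoMeasure 1 1) :=
    isProbabilityMeasure_paretoMeasure one_pos one_pos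
  have hΘm : Measurable fun ω t => Θ t ω := measurable_pi_iff.2 hΘ.measurable
  have hQm : Measurable fun ω t => Z t ω / Z 0 ω :=
    measurable_pi_iff.2 fun t => (hZ t).div (hZ 0)
  have hlaw := (indepFun_iff_map_prod_eq_prod_map_map hΘm.aemeasurable hRm.aemeasurable).1 hRΘ.symm
  rw [hR, hΘ.law] at hlaw
  have hD : MeasurableSet {p : ((Fin d → ℝ) → ℝ) × ℝ | (fun t => p.2 * p.1 t) ∈ B} :=
    (measurable_pi_iff.2 fun t => by fun_prop) hB
  have hsec := measurable_measure_prodMk_left (ν := paretoMeasure 1 1) hD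
  have h := Measure.map_apply (hΘm.prodMk hRm) hD (μ := P₂)
  rw [hlaw, Measure.prod_apply hD, lintegral_map hsec hQm] at h
  exact h.symm.trans
    (lintegral_withDensity_eq_lintegral_mul _ (hZ 0).ennreal_ofReal (hsec.comp hQm))

/-- With `s = Z(0) / r`, the path `r Z / Z(0)` is `Z / s`, and `r` has a Pareto law weighted by
`Z(0)` exactly when `s` is uniform on `(0, Z(0))`, that is when `1 < Z(0) / s`. -/
lemma IsTilted.map_eq_restrict_tailMeasure [SFinite P] [IsFiniteMeasure P₂]
    (hΘ : IsTilted P Z P₂ Θ) (hZ : ∀ t, Measurable (Z t)) {X : Ω → Path d} (hX : Measurable X)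
    (hXZ : ∀ᵐ ω ∂P, (X ω).1 = fun t => Z t ω) (hRm : Measurable R)
    (hR : P₂.map R = paretoMeasure 1 1) (hRΘ : IndepFun R (fun ω t => Θ t ω) P₂)
    {W : Ω₂ → Path d} (hW : Measurable W) (hWY : ∀ᵐ ω ∂P₂, (W ω).1 = fun t => R ω * Θ t ω) :
    P₂.map W = (tailMeasure P X).restrict {f | 1 < f.1 0} := by
  have hm : MeasurableSet {f : Path d | 1 < f.1 0} := measurableSet_lt_eval 1 0
  ext _ ⟨B, hB, rfl⟩
  have hWB : P₂ (W ⁻¹' (Subtype.val ⁻¹' B)) = P₂ {ω | (fun t => R ω * Θ t ω) ∈ B} := by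
    refine measure_congr (eventuallyEq_set.2 ?_)
    filter_upwards [hWY] with ω hω
    simp only [Set.mem_preimage, hω]
  rw [Measure.map_apply hW (measurable_subtype_coe hB), hWB, hΘ.measure_mul_mem hZ hRm hR hRΘ hB,
    Measure.restrict_apply' hm, tailMeasure_inter_one_lt hX hB]
  refine lintegral_congr_ae ?_
  filter_upwards [hXZ] with ω hω
  rw [hω]

end Tilted

section Sojourn

variable {d : ℕ}

lemma gridMeasure_zero : gridMeasure d 0 = volume := by simp [gridMeasure]

lemma gridMeasure_of_ne_zero {δ : ℝ} (hδ : δ ≠ 0) : gridMeasure d δ = ENNReal.ofReal (δ ^ d) •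
    Measure.sum fun k : Fin d → ℤ => Measure.dirac fun i => δ * (k i : ℝ) := by
  simp [gridMeasure, hδ]

instance (δ : ℝ) : SFinite (gridMeasure d δ) := by
  unfold gridMeasure
  split_ifs <;> infer_instance

lemma gridMeasure_apply {δ : ℝ} (hδ : δ ≠ 0) (A : Set (Fin d → ℝ)) :
    gridMeasure d δ A = ENNReal.ofReal (δ ^ d) *
      ∑' k : Fin d → ℤ, A.indicator 1 fun i => δ * (k i : ℝ) := by
  rw [gridMeasure_of_ne_zero hδ, Measure.smul_apply, Measure.sum_apply_of_countable, smul_eq_mul]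
  simp only [Measure.dirac_apply]

lemma ae_mem_grid (δ : ℝ) : ∀ᵐ t ∂(gridMeasure d δ), t ∈ grid d δ := by
  rcases eq_or_ne δ 0 with rfl | hδ
  · exact .of_forall fun t => Or.inl rfl
  · rw [gridMeasure_of_ne_zero hδ]
    refine Measure.ae_smul_measure (Measure.ae_sum_iff.2 fun k => ?_) _
    rw [ae_dirac_eq]
    exact Or.inr ⟨k, rfl⟩

lemma gridMeasure_preimage_add {δ : ℝ} {h : Fin d → ℝ} (hh : h ∈ grid d δ)
    (A : Set (Fin d → ℝ)) : gridMeasure d δ ((· + h) ⁻¹' A) = gridMeasure d δ A := by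
  rcases eq_or_ne δ 0 with rfl | hδ
  · rw [gridMeasure_zero]
    exact measure_preimage_add_right _ _ _
  · obtain ⟨m, rfl⟩ := hh.resolve_left hδ
    rw [gridMeasure_apply hδ, gridMeasure_apply hδ, ← (Equiv.addRight m).tsum_eq
      fun k : Fin d → ℤ => A.indicator (1 : (Fin d → ℝ) → ℝ≥0∞) fun i => δ * (k i : ℝ)]
    congr 1
    refine tsum_congr fun k => ?_
    have hpoint : (fun i => δ * (k i : ℝ)) + (fun i => δ * (m i : ℝ)) =
        fun i => δ * ((Equiv.addRight m k i : ℤ) : ℝ) := by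
      ext i
      simp [mul_add]
    rw [← hpoint]
    rfl

lemma sojourn_eq (δ : ℝ) (A : Set (Fin d → ℝ)) (f : (Fin d → ℝ) → ℝ) (s : ℝ) :
    sojourn δ A f s = gridMeasure d δ (A ∩ {t | s < f t}) := by
  refine measure_congr (eventuallyEq_set.2 ?_)
  filter_upwards [ae_mem_grid δ] with t ht
  simp [ht]

lemma sojourn_lt_top {δ : ℝ} {A : Set (Fin d → ℝ)} (hA : gridMeasure d δ A < ∞)
    (f : (Fin d → ℝ) → ℝ) (s : ℝ) : sojourn δ A f s < ∞ :=
  (measure_mono fun _ ht => ht.1.1).trans_lt hA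

lemma measurable_sojourn (δ : ℝ) {A : Set (Fin d → ℝ)} (hA : MeasurableSet A) (s : ℝ) :
    Measurable fun f : Path d => sojourn δ A f.1 s := by
  simp_rw [sojourn_eq]
  exact measurable_measure_prodMk_left (s := {p : Path d × (Fin d → ℝ) | p.2 ∈ A ∧ s < p.1.1 p.2})
    ((measurable_snd hA).inter (measurableSet_lt measurable_const measurable_uncurry_path))

lemma measurable_epsilon (δ : ℝ) : Measurable fun f : Path d => epsilon δ f.1 :=
  measurable_sojourn δ .univ 1

lemma sojourn_mono (δ : ℝ) {A B : Set (Fin d → ℝ)} (h : A ⊆ B) (f : (Fin d → ℝ) → ℝ) (s : ℝ) :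
    sojourn δ A f s ≤ sojourn δ B f s :=
  measure_mono fun _ ht => ⟨⟨h ht.1.1, ht.1.2⟩, ht.2⟩

lemma sojourn_shift {δ : ℝ} {h : Fin d → ℝ} (hh : h ∈ grid d δ) (A : Set (Fin d → ℝ))
    (f : Path d) (s : ℝ) : sojourn δ ((· + h) ⁻¹' A) (shift h f).1 s = sojourn δ A f.1 s := by
  rw [sojourn_eq, sojourn_eq]
  exact gridMeasure_preimage_add hh (A ∩ {t | s < f.1 t})

lemma epsilon_shift {δ : ℝ} {h : Fin d → ℝ} (hh : h ∈ grid d δ) (f : Path d) :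
    epsilon δ (shift h f).1 = epsilon δ f.1 :=
  sojourn_shift hh Set.univ f 1

lemma sojourn_scale_inv {δ s : ℝ} (hs : 0 < s) (A : Set (Fin d → ℝ)) (f : Path d) :
    sojourn δ A (scale s⁻¹.toNNReal f).1 1 = sojourn δ A f.1 s := by
  simp only [sojourn, scale_inv_toNNReal_apply hs.le, one_lt_div hs]

lemma epsilon_zero_eq_volume (f : (Fin d → ℝ) → ℝ) : epsilon 0 f = volume {t | 1 < f t} := by
  rw [epsilon, sojourn_eq, gridMeasure_zero, Set.univ_inter]

lemma epsilon_eq_tsum {δ : ℝ} (hδ : δ ≠ 0) (f : Path d) :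
    epsilon δ f.1 = ENNReal.ofReal (δ ^ d) *
      ∑' k : Fin d → ℤ,
        {g : Path d | 1 < g.1 0}.indicator 1 (shift (fun i => δ * (k i : ℝ)) f) := by
  rw [epsilon, sojourn_eq, gridMeasure_apply hδ]
  simp [Set.indicator_apply, shift]

end Sojourn

section MassTransport

variable {d : ℕ}

/-- The cell of the lattice `δ ℤ^d` with lower corner `δ k`. -/
def cell (δ : ℝ) (k : Fin d → ℤ) : Set (Fin d → ℝ) := {t | ∀ i, ⌊t i / δ⌋ = k i}

lemma measurableSet_cell (δ : ℝ) (k : Fin d → ℤ) : MeasurableSet (cell δ k) := by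
  have hfloor : Measurable fun (t : Fin d → ℝ) i => ⌊t i / δ⌋ :=
    measurable_pi_iff.2 fun i => Int.measurable_floor.comp (by fun_prop)
  convert hfloor (measurableSet_singleton k) using 1
  ext t
  exact funext_iff.symm

lemma pairwise_disjoint_cell (δ : ℝ) : Pairwise (Function.onFun Disjoint (cell (d := d) δ)) :=
  fun _ _ hkl => Set.disjoint_left.2 fun _ hk hl =>
    hkl (funext fun i => (hk i).symm.trans (hl i))

lemma preimage_add_cell {δ : ℝ} (hδ : δ ≠ 0) (k : Fin d → ℤ) :
    (· + fun i => δ * (k i : ℝ)) ⁻¹' cell δ k = cell δ 0 := by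
  ext t
  refine forall_congr' fun i => ?_
  simp only [Pi.add_apply, Pi.zero_apply]
  rw [add_div, mul_div_cancel_left₀ _ hδ, Int.floor_add_intCast]
  exact add_eq_right

lemma sojourn_cell_shift {δ : ℝ} (hδ : δ ≠ 0) (k : Fin d → ℤ) (f : Path d) (s : ℝ) :
    sojourn 0 (cell δ 0) (shift (fun i => δ * (k i : ℝ)) f).1 s = sojourn 0 (cell δ k) f.1 s := by
  rw [← preimage_add_cell hδ k]
  exact sojourn_shift (Or.inl rfl) _ f s

lemma tsum_sojourn_cell_le (δ : ℝ) (f : Path d) :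
    ∑' k, sojourn 0 (cell δ k) f.1 1 ≤ epsilon 0 f.1 := by
  simp_rw [epsilon, sojourn_eq]
  rw [← measure_iUnion]
  · exact measure_mono
      (Set.iUnion_subset fun k => Set.inter_subset_inter_left _ (Set.subset_univ _))
  · exact fun k l h => (pairwise_disjoint_cell δ h).mono Set.inter_subset_left
      Set.inter_subset_left
  · exact fun k => (measurableSet_cell δ k).inter (measurableSet_superlevel f 1)

lemma sojourn_cell_zero_pos {δ : ℝ} (hδ : 0 < δ) {f : Path d} {s : ℝ} (h : s < f.1 0) :
    0 < sojourn 0 (cell δ 0) f.1 s := by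
  obtain ⟨ε, hε, hb⟩ := exists_box_superlevel f h
  have hsub : Set.pi Set.univ (fun _ : Fin d => Set.Ioo 0 (min ε δ)) ⊆
      cell δ 0 ∩ {t | s < f.1 t} := by
    intro t ht
    have ht' (i) : 0 < t i ∧ t i < min ε δ := ht i trivial
    refine ⟨fun i => ?_, hb t fun i => ⟨(ht' i).1.le, ?_⟩⟩
    · rw [Pi.zero_apply, Int.floor_eq_zero_iff]
      exact ⟨div_nonneg (ht' i).1.le hδ.le,
        (div_lt_one hδ).2 ((ht' i).2.trans_le (min_le_right _ _))⟩
    · simpa using (ht' i).2.trans_le (min_le_left _ _)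
  rw [sojourn_eq, gridMeasure_zero]
  refine lt_of_lt_of_le ?_ (measure_mono hsub)
  rw [volume_pi_pi]
  simp [hε, hδ, pos_iff_ne_zero]

variable {ν : Measure (Path d)} {a b : Path d → ℝ≥0∞}

lemma ShiftInvariant.lintegral_comp_shift_mul (hν : ShiftInvariant ν) (ha : Measurable a)
    (hb : Measurable b) (h : Fin d → ℝ) :
    ∫⁻ f, a (shift h f) * b f ∂ν = ∫⁻ f, a f * b (shift (-h) f) ∂ν := by
  refine Eq.trans (lintegral_congr fun f => ?_) ((hν h).lintegral_comp
    (f := fun f => a f * b (shift (-h) f)) (ha.mul (hb.comp (measurable_shift (-h)))))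
  simp [shift]

lemma ShiftInvariant.lintegral_tsum_comp_shift_mul (hν : ShiftInvariant ν) (ha : Measurable a)
    (hb : Measurable b) (δ : ℝ) :
    ∫⁻ f, (∑' k : Fin d → ℤ, a (shift (fun i => δ * (k i : ℝ)) f)) * b f ∂ν =
      ∫⁻ f, a f * ∑' k : Fin d → ℤ, b (shift (fun i => δ * (k i : ℝ)) f) ∂ν := by
  let p (k : Fin d → ℤ) (i : Fin d) : ℝ := δ * (k i : ℝ)
  have hneg (k : Fin d → ℤ) : -p k = p (-k) := by
    ext i
    simp [p]
  have ha' (k : Fin d → ℤ) : Measurable fun f => a (shift (p k) f) := ha.comp (measurable_shift _)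
  have hb' (k : Fin d → ℤ) : Measurable fun f => b (shift (p k) f) := hb.comp (measurable_shift _)
  calc ∫⁻ f, (∑' k, a (shift (p k) f)) * b f ∂ν
      = ∑' k, ∫⁻ f, a (shift (p k) f) * b f ∂ν := by
        simp_rw [← ENNReal.tsum_mul_right]
        exact lintegral_tsum fun k => ((ha' k).mul hb).aemeasurable
    _ = ∑' k, ∫⁻ f, a f * b (shift (p (-k)) f) ∂ν :=
        tsum_congr fun k => by rw [hν.lintegral_comp_shift_mul ha hb, hneg]
    _ = ∑' k, ∫⁻ f, a f * b (shift (p k) f) ∂ν :=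
        (Equiv.neg (Fin d → ℤ)).tsum_eq fun k => ∫⁻ f, a f * b (shift (p k) f) ∂ν
    _ = ∫⁻ f, a f * ∑' k, b (shift (p k) f) ∂ν := by
        simp_rw [← ENNReal.tsum_mul_left]
        exact (lintegral_tsum fun k => (ha.mul (hb' k)).aemeasurable).symm

/-- Mass transport, with `a` the indicator of an exceedance at `0` and `b` the share of the
excursion volume that lies in the cell at `0`. -/
lemma ShiftInvariant.ae_epsilon_lt_top (hν : ShiftInvariant ν) (hν₀ : ν {f | 1 < f.1 0} < ∞)
    (hfin : ∀ᵐ f ∂ν, epsilon 0 f.1 < ∞) {δ : ℝ} (hδ : 0 < δ) :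
    ∀ᵐ f ∂ν, 1 < f.1 0 → epsilon δ f.1 < ∞ := by
  let a : Path d → ℝ≥0∞ := {f | 1 < f.1 0}.indicator 1
  let b (f : Path d) : ℝ≥0∞ := sojourn 0 (cell δ 0) f.1 1 / epsilon 0 f.1
  have hm : MeasurableSet {f : Path d | 1 < f.1 0} := measurableSet_lt_eval 1 0
  have ha : Measurable a := measurable_one.indicator hm
  have hb : Measurable b := (measurable_sojourn 0 (measurableSet_cell δ 0) 1).div
    (measurable_epsilon 0)
  have hshare (f : Path d) : ∑' k : Fin d → ℤ, b (shift (fun i => δ * (k i : ℝ)) f) ≤ 1 := by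
    simp only [b, sojourn_cell_shift hδ.ne', epsilon_shift (Or.inl rfl), div_eq_mul_inv]
    rw [ENNReal.tsum_mul_right]
    exact (mul_le_mul_left (tsum_sojourn_cell_le δ f) _).trans (ENNReal.mul_inv_le_one _)
  have hbound :
      ∫⁻ f, (∑' k : Fin d → ℤ, a (shift (fun i => δ * (k i : ℝ)) f)) * b f ∂ν ≠ ∞ := by
    rw [hν.lintegral_tsum_comp_shift_mul ha hb]
    refine ((lintegral_mono fun f => mul_le_of_le_one_right' (hshare f)).trans_lt ?_).ne
    rwa [lintegral_indicator_one hm]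
  have hcount : Measurable fun f => ∑' k : Fin d → ℤ, a (shift (fun i => δ * (k i : ℝ)) f) :=
    Measurable.tsum fun k => ha.comp (measurable_shift _)
  filter_upwards [ae_lt_top (hcount.mul hb) hbound, hfin] with f hprod hvol hexceed
  have hbpos : b f ≠ 0 := ENNReal.div_ne_zero.2 ⟨(sojourn_cell_zero_pos hδ hexceed).ne', hvol.ne⟩
  rw [epsilon_eq_tsum hδ.ne']
  exact ENNReal.mul_lt_top ENNReal.ofReal_lt_top (ENNReal.lt_top_of_mul_ne_top_left hprod.ne hbpos)

end MassTransport

section Box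

variable {d : ℕ}

/-- The box `[a, b]^d`; the cube `[0, T]^d` is `box d 0 T` by definition. -/
def box (d : ℕ) (a b : ℝ) : Set (Fin d → ℝ) := Set.Icc (fun _ => a) (fun _ => b)

lemma measurableSet_box (a b : ℝ) : MeasurableSet (box d a b) := measurableSet_Icc

lemma mem_box {a b : ℝ} {t : Fin d → ℝ} : t ∈ box d a b ↔ ∀ i, a ≤ t i ∧ t i ≤ b :=
  ⟨fun h i => ⟨h.1 i, h.2 i⟩, fun h => ⟨fun i => (h i).1, fun i => (h i).2⟩⟩

lemma box_mono {a a' b b' : ℝ} (ha : a' ≤ a) (hb : b ≤ b') : box d a b ⊆ box d a' b' :=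
  Set.Icc_subset_Icc (fun _ => ha) (fun _ => hb)

lemma box_subset_preimage_add {M T : ℝ} {t : Fin d → ℝ} (ht : t ∈ box d M (T - M)) :
    box d (-M) M ⊆ (· + t) ⁻¹' box d 0 T := by
  intro u hu
  rw [mem_box] at ht hu
  refine mem_box.2 fun i => ?_
  have hti := ht i
  have hui := hu i
  simp only [Pi.add_apply]
  constructor <;> linarith

lemma iUnion_box_eq_univ : ⋃ M : ℕ, box d (-M) M = Set.univ := by
  refine Set.eq_univ_of_forall fun t => Set.mem_iUnion.2 ?_
  obtain ⟨M, hM⟩ := exists_nat_ge ‖t‖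
  exact ⟨M, mem_box.2 fun i => abs_le.1 ((norm_le_pi_norm t i).trans hM)⟩

lemma volume_box (a b : ℝ) : volume (box d a b) = ENNReal.ofReal (b - a) ^ d := by
  rw [box, Real.volume_Icc_pi]
  simp

lemma gridMeasure_box {δ : ℝ} (hδ : 0 < δ) (a b : ℝ) : gridMeasure d δ (box d a b) =
    ENNReal.ofReal (δ ^ d) * ((Finset.Icc ⌈a / δ⌉ ⌊b / δ⌋).card : ℝ≥0∞) ^ d := by
  rw [gridMeasure_apply hδ.ne']
  congr 1
  have hmem (k : Fin d → ℤ) : (fun i => δ * (k i : ℝ)) ∈ box d a b ↔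
      k ∈ Fintype.piFinset fun _ : Fin d => Finset.Icc ⌈a / δ⌉ ⌊b / δ⌋ := by
    simp only [mem_box, Fintype.mem_piFinset, Finset.mem_Icc, Int.ceil_le, Int.le_floor,
      div_le_iff₀ hδ, le_div_iff₀ hδ, mul_comm δ]
  rw [tsum_eq_sum fun k hk => Set.indicator_of_notMem (fun h => hk ((hmem k).1 h)) _,
    Finset.sum_congr rfl fun k hk => Set.indicator_of_mem ((hmem k).2 hk) _]
  simp

lemma card_Icc_ceil_floor_le {u v : ℝ} (h : u ≤ v) :
    ((Finset.Icc ⌈u⌉ ⌊v⌋).card : ℝ) ≤ v - u + 1 := by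
  rw [Int.card_Icc, ← Int.cast_natCast, Int.toNat_eq_max, Int.cast_max]
  refine max_le ?_ (by push_cast; linarith)
  push_cast
  linarith [Int.floor_le v, Int.le_ceil u]

lemma sub_one_le_card_Icc_ceil_floor (u v : ℝ) :
    v - u - 1 ≤ ((Finset.Icc ⌈u⌉ ⌊v⌋).card : ℝ) := by
  rw [Int.card_Icc, ← Int.cast_natCast, Int.toNat_eq_max, Int.cast_max]
  refine le_max_of_le_left ?_
  push_cast
  linarith [Int.lt_floor_add_one v, Int.ceil_lt_add_one u]

lemma gridMeasure_box_le {δ : ℝ} (hδ : 0 ≤ δ) {a b : ℝ} (hab : a ≤ b) :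
    gridMeasure d δ (box d a b) ≤ ENNReal.ofReal ((b - a + δ) ^ d) := by
  rw [ENNReal.ofReal_pow (by linarith)]
  rcases hδ.eq_or_lt with rfl | hδ
  · rw [gridMeasure_zero, volume_box, add_zero]
  · rw [gridMeasure_box hδ, ENNReal.ofReal_pow hδ.le, ← mul_pow]
    gcongr
    rw [← ENNReal.ofReal_natCast, ← ENNReal.ofReal_mul hδ.le]
    refine ENNReal.ofReal_le_ofReal ?_
    calc _ ≤ δ * (b / δ - a / δ + 1) := by
          gcongr
          exact card_Icc_ceil_floor_le (by gcongr)
      _ = b - a + δ := by field_simp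

lemma le_gridMeasure_box {δ : ℝ} (hδ : 0 ≤ δ) {a b : ℝ} (hab : δ ≤ b - a) :
    ENNReal.ofReal ((b - a - δ) ^ d) ≤ gridMeasure d δ (box d a b) := by
  rw [ENNReal.ofReal_pow (by linarith)]
  rcases hδ.eq_or_lt with rfl | hδ
  · rw [gridMeasure_zero, volume_box, sub_zero]
  · rw [gridMeasure_box hδ, ENNReal.ofReal_pow hδ.le, ← mul_pow]
    gcongr
    rw [← ENNReal.ofReal_natCast, ← ENNReal.ofReal_mul hδ.le]
    refine ENNReal.ofReal_le_ofReal ?_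
    calc b - a - δ = δ * (b / δ - a / δ - 1) := by field_simp
      _ ≤ _ := by
          gcongr
          exact sub_one_le_card_Icc_ceil_floor _ _

lemma gridMeasure_box_lt_top {δ : ℝ} (hδ : 0 ≤ δ) (a b : ℝ) : gridMeasure d δ (box d a b) < ∞ :=
  (measure_mono (box_mono le_rfl (le_max_right a b))).trans_lt
    ((gridMeasure_box_le hδ (le_max_left a b)).trans_lt ENNReal.ofReal_lt_top)

lemma tendsto_ofReal_sub_pow_div (d : ℕ) (c : ℝ) :
    Tendsto (fun T : ℝ => ENNReal.ofReal ((T - c) ^ d) / ENNReal.ofReal (T ^ d)) atTop (𝓝 1) := by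
  have hreal : Tendsto (fun T : ℝ => (1 - c / T) ^ d) atTop (𝓝 ((1 - 0) ^ d)) :=
    (tendsto_const_nhds.sub (tendsto_const_nhds.div_atTop tendsto_id)).pow d
  have hlim : Tendsto (fun T : ℝ => ENNReal.ofReal ((1 - c / T) ^ d)) atTop (𝓝 1) := by
    simpa using ENNReal.tendsto_ofReal hreal
  refine hlim.congr' ?_
  filter_upwards [eventually_gt_atTop 0] with T hT
  rw [← ENNReal.ofReal_div_of_pos (pow_pos hT d), ← div_pow, sub_div, div_self hT.ne']

lemma tendsto_gridMeasure_box {δ : ℝ} (hδ : 0 ≤ δ) (a c : ℝ) :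
    Tendsto (fun T => gridMeasure d δ (box d a (T - c)) / ENNReal.ofReal (T ^ d)) atTop (𝓝 1) := by
  refine tendsto_of_tendsto_of_tendsto_of_le_of_le' (tendsto_ofReal_sub_pow_div d (c + a + δ))
    (tendsto_ofReal_sub_pow_div d (c + a - δ)) ?_ ?_
  · filter_upwards [eventually_ge_atTop (c + a + δ)] with T hT
    have h := le_gridMeasure_box (d := d) hδ (a := a) (b := T - c) (by linarith)
    rw [show T - c - a - δ = T - (c + a + δ) by ring] at h
    gcongr
  · filter_upwards [eventually_ge_atTop (c + a)] with T hT
    have h := gridMeasure_box_le (d := d) hδ (a := a) (b := T - c) (by linarith)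
    rw [show T - c - a + δ = T - (c + a - δ) by ring] at h
    gcongr

lemma gridMeasure_singleton_zero_pos {δ : ℝ} (hδ : 0 < δ) :
    0 < gridMeasure d δ {0} := by
  have hbox : ({0} : Set (Fin d → ℝ)) = box d 0 0 := (Set.Icc_self _).symm
  rw [hbox, gridMeasure_box hδ]
  simp [pow_pos hδ]

variable {δ M : ℝ} {c C : ℝ≥0∞} {g : ℝ → (Fin d → ℝ) → ℝ≥0∞}

lemma le_liminf_average (hδ : 0 ≤ δ) (hM : 0 ≤ M)
    (hg : ∀ T, ∀ t ∈ box d M (T - M), c ≤ g T t) :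
    c ≤ liminf (fun T => (∫⁻ t in box d 0 T, g T t ∂(gridMeasure d δ)) / ENNReal.ofReal (T ^ d))
      atTop := by
  have hlim := ENNReal.Tendsto.const_mul (a := c) (tendsto_gridMeasure_box (d := d) hδ M M)
    (Or.inl one_ne_zero)
  rw [mul_one] at hlim
  rw [← hlim.liminf_eq]
  refine liminf_le_liminf (.of_forall fun T => ?_)
  rw [← mul_div_assoc, ← setLIntegral_const]
  gcongr ?_ / _
  exact (setLIntegral_mono' (measurableSet_box _ _) (hg T)).trans
    (lintegral_mono_set (box_mono hM (sub_le_self T hM)))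

lemma gridMeasure_box_diff_div (hδ : 0 ≤ δ) (hM : 0 ≤ M) {T : ℝ} (hT : 0 < T) :
    gridMeasure d δ (box d 0 T \ box d M (T - M)) / ENNReal.ofReal (T ^ d) =
      gridMeasure d δ (box d 0 (T - 0)) / ENNReal.ofReal (T ^ d) -
        gridMeasure d δ (box d M (T - M)) / ENNReal.ofReal (T ^ d) := by
  rw [measure_sdiff (box_mono hM (sub_le_self T hM)) (measurableSet_box _ _).nullMeasurableSet
    (gridMeasure_box_lt_top hδ _ _).ne, ENNReal.sub_div, sub_zero]
  simp [pow_pos hT]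

lemma limsup_average_le (hδ : 0 ≤ δ) (hM : 0 ≤ M) (hC : C ≠ ∞)
    (hg : ∀ T, ∀ t ∈ box d M (T - M), g T t ≤ c) (hgC : ∀ T, ∀ t ∈ box d 0 T, g T t ≤ C) :
    limsup (fun T => (∫⁻ t in box d 0 T, g T t ∂(gridMeasure d δ)) / ENNReal.ofReal (T ^ d)) atTop
      ≤ c := by
  have hinner := tendsto_gridMeasure_box (d := d) hδ M M
  have hlim := (ENNReal.Tendsto.const_mul (a := c) hinner (Or.inl one_ne_zero)).add
    (ENNReal.Tendsto.const_mul (a := C)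
      (ENNReal.Tendsto.sub (tendsto_gridMeasure_box (d := d) hδ 0 0)
        hinner (Or.inl ENNReal.one_ne_top)) (Or.inr hC))
  rw [tsub_self, mul_zero, add_zero, mul_one] at hlim
  rw [← hlim.limsup_eq]
  refine limsup_le_limsup ?_
  filter_upwards [eventually_gt_atTop 0] with T hT
  rw [← gridMeasure_box_diff_div hδ hM hT, ← mul_div_assoc, ← mul_div_assoc,
    ENNReal.div_add_div_same, ← lintegral_inter_add_sdiff _ (box d 0 T)
      (measurableSet_box M (T - M)), Set.inter_eq_right.2 (box_mono hM (sub_le_self T hM)),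
    ← setLIntegral_const, ← setLIntegral_const]
  gcongr ?_ / _
  exact add_le_add (setLIntegral_mono' (measurableSet_box _ _) (hg T))
    (setLIntegral_mono' ((measurableSet_box _ _).diff (measurableSet_box _ _))
      fun t ht => hgC T t ht.1)

end Box

section TruncInv

/-- `max(x, l')⁻¹` on the event `x < l`. On the diagonal this is `𝟙(l > x) / l`; separating the two
occurrences of `l` makes the expression monotone in each of them. -/
def truncInv (x l l' : ℝ≥0∞) : ℝ≥0∞ := if x < l then (max x l')⁻¹ else 0

lemma truncInv_le (x l l' : ℝ≥0∞) : truncInv x l l' ≤ (max x l')⁻¹ := by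
  unfold truncInv
  split_ifs
  exacts [le_rfl, zero_le]

lemma truncInv_mono {x l₁ l₂ l₁' l₂' : ℝ≥0∞} (hl : l₁ ≤ l₂) (hl' : l₂' ≤ l₁') :
    truncInv x l₁ l₁' ≤ truncInv x l₂ l₂' := by
  by_cases h : x < l₁
  · rw [truncInv, truncInv, if_pos h, if_pos (h.trans_le hl), ENNReal.inv_le_inv]
    exact max_le_max_left x hl'
  · rw [truncInv, if_neg h]
    exact zero_le

lemma truncInv_self_mul {x l : ℝ≥0∞} (hl : l ≠ ∞) :
    truncInv x l l * l = if x < l then 1 else 0 := by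
  unfold truncInv
  split_ifs with h
  · rw [max_eq_right h.le, ENNReal.inv_mul_cancel (zero_le.trans_lt h).ne' hl]
  · exact zero_mul l

lemma truncInv_self_ne_zero {x l : ℝ≥0∞} (h : x < l) (hl : l ≠ ∞) : truncInv x l l ≠ 0 := by
  rw [truncInv, if_pos h, max_eq_right h.le]
  exact ENNReal.inv_ne_zero.2 hl

lemma measurable_truncInv {α : Type*} [MeasurableSpace α] (x : ℝ≥0∞) {g g' : α → ℝ≥0∞}
    (hg : Measurable g) (hg' : Measurable g') : Measurable fun a => truncInv x (g a) (g' a) :=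
  Measurable.ite (measurableSet_lt measurable_const hg) (measurable_const.max hg').inv
    measurable_const

variable {x l l' : ℝ≥0∞} {u : ℕ → ℝ≥0∞}

lemma tendsto_truncInv_left (hu : Tendsto u atTop (𝓝 l)) (hul : ∀ n, u n ≤ l) :
    Tendsto (fun n => truncInv x (u n) l') atTop (𝓝 (truncInv x l l')) := by
  refine tendsto_const_nhds.congr' ?_
  by_cases h : x < l
  · filter_upwards [hu.eventually (lt_mem_nhds h)] with n hn
    simp only [truncInv, if_pos h, if_pos hn]
  · refine .of_forall fun n => ?_
    simp only [truncInv, if_neg h, if_neg fun hn : x < u n => h (hn.trans_le (hul n))]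

lemma tendsto_truncInv_right (hu : Tendsto u atTop (𝓝 l')) :
    Tendsto (fun n => truncInv x l (u n)) atTop (𝓝 (truncInv x l l')) := by
  unfold truncInv
  split_ifs
  exacts [(tendsto_const_nhds.max hu).inv, tendsto_const_nhds]

end TruncInv

section Limit

variable {d : ℕ} {ν : Measure (Path d)} {δ : ℝ} {x : ℝ≥0∞}

lemma lintegral_indicator_superlevel (δ : ℝ) (A : Set (Fin d → ℝ)) (f : Path d) (c : ℝ≥0∞) :
    ∫⁻ t in A, {t | 1 < f.1 t}.indicator (fun _ => c) t ∂(gridMeasure d δ) =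
      c * sojourn δ A f.1 1 := by
  rw [lintegral_indicator_const (measurableSet_superlevel f 1),
    Measure.restrict_apply (measurableSet_superlevel f 1), Set.inter_comm, sojourn_eq]

/-- The identity `𝟙(l > x) = ∫_A 𝟙(f(t) > 1) 𝟙(l > x) / l λ_δ(dt)` for the sojourn `l` in `A`
spreads the event over its exceedance points, each of which is then shifted to the origin. -/
lemma ShiftInvariant.measure_lt_sojourn [SFinite ν] (hν : ShiftInvariant ν) (x : ℝ≥0∞)
    {A : Set (Fin d → ℝ)} (hA : MeasurableSet A) (hfin : gridMeasure d δ A < ∞) :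
    ν {f | x < sojourn δ A f.1 1} = ∫⁻ t in A, ∫⁻ f in {f | 1 < f.1 0},
      truncInv x (sojourn δ ((· + t) ⁻¹' A) f.1 1) (sojourn δ ((· + t) ⁻¹' A) f.1 1) ∂ν
        ∂(gridMeasure d δ) := by
  let w (B : Set (Fin d → ℝ)) (f : Path d) : ℝ≥0∞ :=
    truncInv x (sojourn δ B f.1 1) (sojourn δ B f.1 1)
  have hw {B : Set (Fin d → ℝ)} (hB : MeasurableSet B) : Measurable (w B) :=
    measurable_truncInv x (measurable_sojourn δ hB 1) (measurable_sojourn δ hB 1)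
  have hspread (f : Path d) : {f : Path d | x < sojourn δ A f.1 1}.indicator 1 f =
      ∫⁻ t in A, {t | 1 < f.1 t}.indicator (fun _ => w A f) t ∂(gridMeasure d δ) := by
    rw [lintegral_indicator_superlevel, truncInv_self_mul (sojourn_lt_top hfin f.1 1).ne]
    simp [Set.indicator_apply]
  have hG : Measurable (Function.uncurry fun (f : Path d) (t : Fin d → ℝ) =>
      {t | 1 < f.1 t}.indicator (fun _ => w A f) t) :=
    ((hw hA).comp measurable_fst).indicator
      (measurableSet_lt measurable_const measurable_uncurry_path)
  rw [← lintegral_indicator_one (measurableSet_lt measurable_const (measurable_sojourn δ hA 1)),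
    lintegral_congr hspread, lintegral_lintegral_swap hG.aemeasurable]
  refine lintegral_congr_ae (ae_restrict_of_ae ?_)
  filter_upwards [ae_mem_grid δ] with t ht
  change _ = ∫⁻ f in {f | 1 < f.1 0}, w ((· + t) ⁻¹' A) f ∂ν
  rw [← lintegral_indicator (measurableSet_lt_eval 1 0), ← (hν t).lintegral_comp
    ((hw (measurable_add_const t hA)).indicator (measurableSet_lt_eval 1 0))]
  refine lintegral_congr fun f => ?_
  have hzero : (shift t f).1 0 = f.1 t := by simp [shift]
  simp only [w, Set.indicator_apply, Set.mem_ofPred_eq, sojourn_shift ht, hzero]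

/-- The Berman ratio `T^{-d} ν(sojourn above 1 in [0,T]^d > x)` of a measure on path space. -/
def exceedRatio (ν : Measure (Path d)) (δ : ℝ) (x : ℝ≥0∞) (T : ℝ) : ℝ≥0∞ :=
  ν {f | x < sojourn δ (box d 0 T) f.1 1} / ENNReal.ofReal (T ^ d)

/-- The value `E[𝟙(ε_δ(Y) > x) / ε_δ(Y)]` of the Berman function, with the law of `Y` given as the
restriction of `ν` to the paths that exceed `1` at the origin; the integrand is `0` if
`ε_δ(Y) = ∞`. -/
def palmInverseSojourn (ν : Measure (Path d)) (δ : ℝ) (x : ℝ≥0∞) : ℝ≥0∞ :=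
  ∫⁻ f in {f | 1 < f.1 0}, truncInv x (epsilon δ f.1) (epsilon δ f.1) ∂ν

lemma tendsto_sojourn_box (δ : ℝ) (f : Path d) :
    Tendsto (fun M : ℕ => sojourn δ (box d (-M) M) f.1 1) atTop (𝓝 (epsilon δ f.1)) := by
  have hmono : Monotone fun M : ℕ => box d (-M) M ∩ {t | 1 < f.1 t} := fun M N h =>
    Set.inter_subset_inter_left _ (box_mono (by gcongr) (by gcongr))
  simp_rw [epsilon, sojourn_eq, ← iUnion_box_eq_univ, Set.iUnion_inter]
  exact tendsto_measure_iUnion_atTop hmono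

lemma sojourn_le_epsilon (δ : ℝ) (A : Set (Fin d → ℝ)) (f : (Fin d → ℝ) → ℝ) :
    sojourn δ A f 1 ≤ epsilon δ f :=
  sojourn_mono δ (Set.subset_univ A) f 1

lemma ShiftInvariant.palmInverseSojourn_le_liminf [SFinite ν] (hν : ShiftInvariant ν)
    (hδ : 0 ≤ δ) : palmInverseSojourn ν δ x ≤ liminf (exceedRatio ν δ x) atTop := by
  have hmeas (M : ℕ) := measurable_truncInv x
    (measurable_sojourn (d := d) δ (measurableSet_box (-M) M) 1) (measurable_epsilon δ)
  refine le_of_tendsto' (lintegral_tendsto_of_tendsto_of_monotone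
    (fun M => (hmeas M).aemeasurable) (.of_forall fun f M N h => ?_) (.of_forall fun f => ?_))
    fun M : ℕ => ?_
  · exact truncInv_mono (sojourn_mono δ (box_mono (by gcongr) (by gcongr)) f.1 1) le_rfl
  · exact tendsto_truncInv_left (tendsto_sojourn_box δ f) fun M => sojourn_le_epsilon δ _ f.1
  · unfold exceedRatio
    simp only [hν.measure_lt_sojourn x (measurableSet_box 0 _)
      (gridMeasure_box_lt_top hδ 0 _)]
    refine le_liminf_average hδ M.cast_nonneg fun T t ht => lintegral_mono fun f => ?_
    exact truncInv_mono (sojourn_mono δ (box_subset_preimage_add ht) f.1 1)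
      (sojourn_le_epsilon δ _ f.1)

lemma truncInv_sojourn_le {A : Set (Fin d → ℝ)} (hA : 0 ∈ A) {f : Path d} (hf : 1 < f.1 0)
    (l : ℝ≥0∞) :
    truncInv x l (sojourn δ A f.1 1) ≤ (max x (gridMeasure d δ {0}))⁻¹ := by
  refine (truncInv_le _ _ _).trans (ENNReal.inv_le_inv.2 (max_le_max_left x ?_))
  rw [sojourn_eq]
  exact measure_mono (Set.singleton_subset_iff.2 ⟨hA, hf⟩)

lemma lintegral_truncInv_sojourn_le (hν : ν {f | 1 < f.1 0} = 1) {A : Set (Fin d → ℝ)}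
    (hA : 0 ∈ A) (l : Path d → ℝ≥0∞) :
    ∫⁻ f in {f | 1 < f.1 0}, truncInv x (l f) (sojourn δ A f.1 1) ∂ν ≤
      (max x (gridMeasure d δ {0}))⁻¹ := by
  refine (setLIntegral_mono' (measurableSet_lt_eval 1 0)
    fun f hf => truncInv_sojourn_le hA hf (l f)).trans_eq ?_
  rw [setLIntegral_const, hν, mul_one]

lemma ShiftInvariant.limsup_le_palmInverseSojourn [SFinite ν] (hν : ShiftInvariant ν)
    (hν₁ : ν {f | 1 < f.1 0} = 1) (hδ : 0 ≤ δ) (hx : max x (gridMeasure d δ {0}) ≠ 0) :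
    limsup (exceedRatio ν δ x) atTop ≤ palmInverseSojourn ν δ x := by
  have hC := ENNReal.inv_ne_top.2 hx
  have hmeas (M : ℕ) := measurable_truncInv x (measurable_epsilon δ)
    (measurable_sojourn (d := d) δ (measurableSet_box (-M) M) 1)
  have hzero (M : ℕ) : (0 : Fin d → ℝ) ∈ box d (-M) M := mem_box.2 fun i => by simp
  refine ge_of_tendsto' (tendsto_lintegral_of_dominated_convergence
    (fun _ => (max x (gridMeasure d δ {0}))⁻¹) hmeas (fun M => ?_) ?_
    (.of_forall fun f => tendsto_truncInv_right (tendsto_sojourn_box δ f))) fun M : ℕ => ?_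
  · exact (ae_restrict_iff' (measurableSet_lt_eval 1 0)).2
      (.of_forall fun f hf => truncInv_sojourn_le (hzero M) hf _)
  · rwa [setLIntegral_const, hν₁, mul_one]
  · unfold exceedRatio
    simp only [hν.measure_lt_sojourn x (measurableSet_box 0 _)
      (gridMeasure_box_lt_top hδ 0 _)]
    refine limsup_average_le hδ M.cast_nonneg hC (fun T t ht => lintegral_mono fun f => ?_)
      fun T t ht => lintegral_truncInv_sojourn_le hν₁ (by simpa using ht) _
    exact truncInv_mono (sojourn_le_epsilon δ _ f.1)
      (sojourn_mono δ (box_subset_preimage_add ht) f.1 1)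

lemma palmInverseSojourn_lt_top (hν : ν {f | 1 < f.1 0} = 1)
    (hx : max x (gridMeasure d δ {0}) ≠ 0) : palmInverseSojourn ν δ x < ∞ :=
  (lintegral_truncInv_sojourn_le hν (Set.mem_univ 0) _).trans_lt (ENNReal.inv_lt_top.2
    (pos_iff_ne_zero.2 hx))

lemma palmInverseSojourn_pos
    (h : 0 < ν {f | 1 < f.1 0 ∧ x < epsilon δ f.1 ∧ epsilon δ f.1 < ∞}) :
    0 < palmInverseSojourn ν δ x := by
  rw [palmInverseSojourn,
    setLIntegral_pos_iff (measurable_truncInv x (measurable_epsilon δ) (measurable_epsilon δ))]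
  exact h.trans_le (measure_mono fun f hf => ⟨truncInv_self_ne_zero hf.2.1 hf.2.2.ne, hf.1⟩)

end Limit

section Subadditive

variable {d : ℕ} {ν : Measure (Path d)}

lemma exists_subcube_of_mem_box {m T : ℝ} (hm : 0 < m) {t : Fin d → ℝ} (ht : t ∈ box d 0 T) :
    ∃ k : Fin d → Fin (⌊T / m⌋₊ + 1), t ∈ (· + fun i => -(m * (k i : ℕ))) ⁻¹' box d 0 m := by
  rw [mem_box] at ht
  have hk (i) : ⌊t i / m⌋₊ < ⌊T / m⌋₊ + 1 :=
    Nat.lt_succ_of_le (Nat.floor_le_floor (div_le_div_of_nonneg_right (ht i).2 hm.le))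
  refine ⟨fun i => ⟨⌊t i / m⌋₊, hk i⟩, mem_box.2 fun i => ?_⟩
  have hle := (le_div_iff₀ hm).1 (Nat.floor_le (div_nonneg (ht i).1 hm.le))
  have hlt := (div_lt_iff₀ hm).1 (Nat.lt_floor_add_one (t i / m))
  simp only [Pi.add_apply]
  constructor <;> linarith

lemma ShiftInvariant.measure_pos_sojourn_preimage_add (hν : ShiftInvariant ν)
    {A : Set (Fin d → ℝ)} (hA : MeasurableSet A) (h : Fin d → ℝ) :
    ν {f | 0 < sojourn 0 ((· + h) ⁻¹' A) f.1 1} = ν {f | 0 < sojourn 0 A f.1 1} := by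
  have hm : MeasurableSet {f : Path d | 0 < sojourn 0 ((· + h) ⁻¹' A) f.1 1} :=
    measurableSet_lt measurable_const (measurable_sojourn 0 (measurable_add_const h hA) 1)
  rw [← (hν h).measure_preimage hm.nullMeasurableSet]
  congr 1
  ext f
  simp only [Set.mem_preimage, Set.mem_ofPred_eq, sojourn_shift (δ := 0) (h := h) (Or.inl rfl)]

lemma ShiftInvariant.measure_pos_sojourn_box_le (hν : ShiftInvariant ν) {m T : ℝ} (hm : 0 < m) :
    ν {f | 0 < sojourn 0 (box d 0 T) f.1 1} ≤
      ((⌊T / m⌋₊ + 1 : ℕ) : ℝ≥0∞) ^ d * ν {f | 0 < sojourn 0 (box d 0 m) f.1 1} := by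
  let h (k : Fin d → Fin (⌊T / m⌋₊ + 1)) (i : Fin d) : ℝ := -(m * (k i : ℕ))
  have hsub : {f : Path d | 0 < sojourn 0 (box d 0 T) f.1 1} ⊆
      ⋃ k, {f | 0 < sojourn 0 ((· + h k) ⁻¹' box d 0 m) f.1 1} := by
    rintro f (hf : 0 < sojourn 0 (box d 0 T) f.1 1)
    by_contra hne
    simp only [Set.mem_iUnion, Set.mem_ofPred_eq, not_exists, not_lt, nonpos_iff_eq_zero] at hne
    refine hf.ne' (measure_mono_null (fun t ht => ?_) (measure_iUnion_null hne))
    obtain ⟨k, hk⟩ := exists_subcube_of_mem_box hm ht.1.1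
    exact Set.mem_iUnion.2 ⟨k, ⟨hk, ht.1.2⟩, ht.2⟩
  refine (measure_mono hsub).trans ((measure_iUnion_fintype_le _ _).trans_eq ?_)
  simp_rw [hν.measure_pos_sojourn_preimage_add (measurableSet_box 0 m)]
  simp

lemma ShiftInvariant.limsup_exceedRatio_zero_le (hν : ShiftInvariant ν) {m : ℝ} (hm : 0 < m) :
    limsup (exceedRatio ν 0 0) atTop ≤ exceedRatio ν 0 0 m := by
  have hlim := ENNReal.Tendsto.mul_const (b := exceedRatio ν 0 0 m)
    (tendsto_ofReal_sub_pow_div d (-m)) (Or.inl one_ne_zero)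
  rw [one_mul] at hlim
  rw [← hlim.limsup_eq]
  refine limsup_le_limsup ?_
  filter_upwards [eventually_gt_atTop 0] with T hT
  have hcount : ((⌊T / m⌋₊ + 1 : ℕ) : ℝ≥0∞) ^ d ≤
      ENNReal.ofReal ((T - -m) ^ d) / ENNReal.ofReal (m ^ d) := by
    rw [← ENNReal.ofReal_div_of_pos (pow_pos hm d), ← div_pow,
      ENNReal.ofReal_pow (div_nonneg (by linarith) hm.le), ← ENNReal.ofReal_natCast]
    gcongr
    push_cast
    rw [sub_neg_eq_add, add_div, div_self hm.ne']
    linarith [Nat.floor_le (div_nonneg hT.le hm.le)]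
  calc exceedRatio ν 0 0 T
      ≤ ENNReal.ofReal ((T - -m) ^ d) / ENNReal.ofReal (m ^ d) *
          ν {f | 0 < sojourn 0 (box d 0 m) f.1 1} / ENNReal.ofReal (T ^ d) := by
        rw [exceedRatio]
        gcongr
        exact (hν.measure_pos_sojourn_box_le hm).trans (by gcongr)
    _ = _ := by
        rw [exceedRatio]
        simp only [div_eq_mul_inv]
        ring

/-- At level `0` the factor `1 / ε` is not bounded, so that averaging over the cube gives no upper
bound; the existence of the limit comes from subadditivity instead. -/
lemma ShiftInvariant.exists_tendsto_exceedRatio_zero (hν : ShiftInvariant ν)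
    (hfin : ν {f | 0 < sojourn 0 (box d 0 1) f.1 1} < ∞) :
    ∃ l < ∞, Tendsto (exceedRatio ν 0 0) atTop (𝓝 l) := by
  have hone : exceedRatio ν 0 0 1 < ∞ := ENNReal.div_lt_top hfin.ne (by simp)
  refine ⟨⨅ m > 0, exceedRatio ν 0 0 m, (iInf₂_le 1 one_pos).trans_lt hone,
    tendsto_of_le_liminf_of_limsup_le ?_ ?_⟩
  · refine le_liminf_of_le (by isBoundedDefault) ?_
    filter_upwards [eventually_gt_atTop 0] with T hT using iInf₂_le T hT
  · exact le_iInf₂ fun m hm => hν.limsup_exceedRatio_zero_le hm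

lemma ShiftInvariant.exists_tendsto_exceedRatio [SFinite ν] (hν : ShiftInvariant ν)
    (hν₁ : ν {f | 1 < f.1 0} = 1) (hfin : ν {f | 0 < sojourn 0 (box d 0 1) f.1 1} < ∞)
    {δ : ℝ} (hδ : 0 ≤ δ) {x : ℝ≥0∞}
    (hx : 0 < ν {f | 1 < f.1 0 ∧ x < epsilon δ f.1 ∧ epsilon δ f.1 < ∞}) :
    ∃ l, Tendsto (exceedRatio ν δ x) atTop (𝓝 l) ∧ 0 < l ∧ l < ∞ := by
  have hlow := hν.palmInverseSojourn_le_liminf (x := x) hδ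
  have hpos := palmInverseSojourn_pos hx
  by_cases hmax : max x (gridMeasure d δ {0}) = 0
  · obtain ⟨rfl, hgrid⟩ := max_eq_zero.1 hmax
    obtain rfl : 0 = δ := hδ.eq_of_not_lt fun h => (gridMeasure_singleton_zero_pos h).ne' hgrid
    obtain ⟨l, hl, ht⟩ := hν.exists_tendsto_exceedRatio_zero hfin
    exact ⟨l, ht, hpos.trans_le (hlow.trans_eq ht.liminf_eq), hl⟩
  · exact ⟨_, tendsto_of_le_liminf_of_limsup_le hlow
      (hν.limsup_le_palmInverseSojourn hν₁ hδ hmax), hpos, palmInverseSojourn_lt_top hν₁ hmax⟩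

end Subadditive

section Continuity

lemma measure_superlevel_lt {E : Type*} [TopologicalSpace E] [PreconnectedSpace E]
    [MeasurableSpace E] [OpensMeasurableSpace E] {μ : Measure E} [μ.IsOpenPosMeasure] {g : E → ℝ}
    (hg : Continuous g) (hμ : μ Set.univ = ∞) {s s' : ℝ} (hs : s < s') (hs' : ∃ t, s' < g t)
    (hfin : μ {t | s < g t} ≠ ∞) : μ {t | s' < g t} < μ {t | s < g t} := by
  obtain ⟨a, ha⟩ : ∃ a, g a ≤ s := by
    by_contra! h
    exact hfin ((Set.eq_univ_of_forall h : {t | s < g t} = Set.univ) ▸ hμ)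
  obtain ⟨b, hb⟩ := hs'
  obtain ⟨u, hu⟩ := mem_range_of_exists_le_of_exists_ge hg (c := (s + s') / 2)
    ⟨a, by linarith⟩ ⟨b, by linarith⟩
  have hopen : IsOpen {t | s < g t ∧ g t < s'} :=
    (isOpen_lt continuous_const hg).inter (isOpen_lt hg continuous_const)
  have hpos := hopen.measure_ne_zero μ ⟨u, by rw [hu]; linarith, by rw [hu]; linarith⟩
  have hsub : {t | s' < g t} ⊆ {t | s < g t} := fun t ht => hs.trans ht
  calc μ {t | s' < g t} < μ {t | s' < g t} + μ {t | s < g t ∧ g t < s'} :=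
        ENNReal.lt_add_right (ne_top_of_le_ne_top hfin (measure_mono hsub)) hpos
    _ = μ ({t | s' < g t} ∪ {t | s < g t ∧ g t < s'}) :=
        (measure_union (Set.disjoint_left.2 fun t ht h => lt_asymm ht h.2)
          hopen.measurableSet).symm
    _ ≤ μ {t | s < g t} := measure_mono (Set.union_subset hsub fun t ht => ht.1)

lemma subsingleton_level_of_measure_superlevel_eq {E : Type*} [TopologicalSpace E]
    [PreconnectedSpace E] [MeasurableSpace E] [OpensMeasurableSpace E] {μ : Measure E}
    [μ.IsOpenPosMeasure] {g : E → ℝ} (hg : Continuous g) (hμ : μ Set.univ = ∞) (t₀ : E)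
    {x : ℝ≥0∞} (hx : x ≠ ∞) : {s | s < g t₀ ∧ μ {t | s < g t} = x}.Subsingleton := by
  have hanti : StrictAntiOn (fun s => μ {t | s < g t}) {s | s < g t₀ ∧ μ {t | s < g t} = x} :=
    fun s hs s' hs' hlt => measure_superlevel_lt hg hμ hlt ⟨t₀, hs'.1⟩ (hs.2.trans_ne hx)
  exact fun s hs s' hs' => hanti.injOn hs hs' (hs.2.trans hs'.2.symm)

variable {d : ℕ} {Ω : Type*} [MeasurableSpace Ω] {P : Measure Ω} {X : Ω → Path d}

lemma tailMeasure_epsilon_zero_eq (hd : 1 ≤ d) (hX : Measurable X)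
    (hc : ∀ᵐ ω ∂P, Continuous (X ω).1) {x : ℝ≥0∞} (hx : x ≠ ∞) :
    tailMeasure P X {f | 1 < f.1 0 ∧ epsilon 0 f.1 = x} = 0 := by
  have : Nonempty (Fin d) := ⟨⟨0, hd⟩⟩
  have hm : MeasurableSet {f : Path d | 1 < f.1 0 ∧ epsilon 0 f.1 = x} :=
    (measurableSet_lt_eval 1 0).inter (measurable_epsilon 0 (measurableSet_singleton x))
  rw [tailMeasure_apply hX hm, ← lintegral_zero (μ := P)]
  refine lintegral_congr_ae ?_
  filter_upwards [hc] with ω hω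
  refine ((subsingleton_level_of_measure_superlevel_eq hω
    (measure_univ_of_isAddLeftInvariant volume) 0 hx).anti ?_).measure_zero volume
  rintro s ⟨hs, hexceed, hε⟩
  simp only [epsilon_zero_eq_volume, scale_inv_toNNReal_apply hs.le, one_lt_div hs] at hexceed hε
  exact ⟨hexceed, hε⟩

end Continuity

section Main

variable {d : ℕ} {Ω Ω₂ : Type*} [MeasurableSpace Ω] [MeasurableSpace Ω₂] {P : Measure Ω}
  {P₂ : Measure Ω₂} {Z : (Fin d → ℝ) → Ω → ℝ} {X : Ω → Path d}

lemma bermanRatio_eq_exceedRatio [SFinite P] (hX : Measurable X)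
    (hXZ : ∀ᵐ ω ∂P, (X ω).1 = fun t => Z t ω) (δ x T : ℝ) :
    bermanRatio P Z δ x T = exceedRatio (tailMeasure P X) δ (ENNReal.ofReal x) T := by
  have hA : MeasurableSet {f : Path d | ENNReal.ofReal x < sojourn δ (box d 0 T) f.1 1} :=
    measurableSet_lt measurable_const (measurable_sojourn δ (measurableSet_box 0 T) 1)
  rw [bermanRatio, exceedRatio, bermanOn, tailMeasure,
    Measure.map_apply (measurable_scale_inv hX) hA,
    Measure.prod_apply_symm (measurable_scale_inv hX hA)]
  congr 1
  refine setLIntegral_congr_fun measurableSet_Ioi fun s hs => measure_congr (eventuallyEq_set.2 ?_)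
  filter_upwards [hXZ] with ω hω
  simp only [Set.mem_preimage, Set.mem_ofPred_eq, sojourn_scale_inv hs, hω]
  rfl

lemma volume_Ioi_inter_ofReal_lt (a : ℝ≥0∞) :
    volume (Set.Ioi 0 ∩ {s : ℝ | ENNReal.ofReal s < a}) = a := by
  rcases eq_or_ne a ∞ with rfl | ha
  · simp
  have hIoo : Set.Ioi 0 ∩ {s : ℝ | ENNReal.ofReal s < a} = Set.Ioo 0 a.toReal := by
    ext s
    exact and_congr_right fun hs => ENNReal.ofReal_lt_iff_lt_toReal (Set.mem_Ioi.1 hs).le ha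
  rw [hIoo, Real.volume_Ioo, sub_zero, ENNReal.ofReal_toReal ha]

lemma tailMeasure_pos_sojourn_cube_lt_top (hZ : IsSpectralField P Z) (hX : Measurable X)
    (hXZ : ∀ᵐ ω ∂P, (X ω).1 = fun t => Z t ω) :
    tailMeasure P X {f | 0 < sojourn 0 (cube d 1) f.1 1} < ∞ := by
  have hm : MeasurableSet {f : Path d | 0 < sojourn 0 (cube d 1) f.1 1} :=
    measurableSet_lt measurable_const (measurable_sojourn 0 (measurableSet_box 0 1) 1)
  rw [tailMeasure_apply hX hm]
  refine lt_of_le_of_lt (lintegral_mono_ae ?_) (hZ.sup_integrable 1 one_pos)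
  filter_upwards [hXZ] with ω hω
  refine (measure_mono ?_).trans (volume_Ioi_inter_ofReal_lt _).le
  rintro s ⟨hs, hpos⟩
  refine ⟨hs, ?_⟩
  rw [sojourn_scale_inv hs, hω] at hpos
  obtain ⟨t, ht, hst⟩ := nonempty_of_measure_ne_zero hpos.ne'
  exact ((ENNReal.ofReal_lt_ofReal_iff_of_nonneg hs.le).2 hst).trans_le
    (le_iSup₂ (f := fun t _ => ENNReal.ofReal (Z t ω)) t ht.1)

lemma ae_tailMeasure_epsilon_zero_lt_top (hX : Measurable X)
    (hS : ∀ᵐ ω ∂P, totalMass (X ω).1 < ∞) :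
    ∀ᵐ f ∂(tailMeasure P X), epsilon 0 f.1 < ∞ := by
  refine ae_tailMeasure_of_forall_scale hX
    (measurableSet_lt (measurable_epsilon 0) measurable_const) ?_
  filter_upwards [hS] with ω hω s hs
  have hm : Measurable fun t => ENNReal.ofReal ((X ω).1 t) :=
    (measurable_uncurry_path.comp measurable_prodMk_left).ennreal_ofReal
  simp only [epsilon_zero_eq_volume, scale_inv_toNNReal_apply hs.le, one_lt_div hs]
  calc volume {t | s < (X ω).1 t}
      ≤ volume {t | ENNReal.ofReal s ≤ ENNReal.ofReal ((X ω).1 t)} :=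
        measure_mono fun t (ht : s < _) => ENNReal.ofReal_le_ofReal ht.le
    _ ≤ totalMass (X ω).1 / ENNReal.ofReal s :=
        meas_ge_le_lintegral_div hm.aemeasurable (by simpa using hs) ENNReal.ofReal_ne_top
    _ < ∞ := ENNReal.div_lt_top hω.ne (by simpa using hs)

lemma ShiftInvariant.ae_epsilon_lt_top_of_nonneg {ν : Measure (Path d)}
    (hν : ShiftInvariant ν) (hν₀ : ν {f | 1 < f.1 0} < ∞) (hfin : ∀ᵐ f ∂ν, epsilon 0 f.1 < ∞)
    {δ : ℝ} (hδ : 0 ≤ δ) : ∀ᵐ f ∂ν, 1 < f.1 0 → epsilon δ f.1 < ∞ := by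
  rcases hδ.eq_or_lt with rfl | hδ
  · exact hfin.mono fun f hf _ => hf
  · exact hν.ae_epsilon_lt_top hν₀ hfin hδ

lemma IsTilted.exists_measurable_path_mul {Θ : (Fin d → ℝ) → Ω₂ → ℝ} {R : Ω₂ → ℝ}
    (hΘ : IsTilted P Z P₂ Θ) (hRm : Measurable R) (hR : P₂.map R = paretoMeasure 1 1) :
    ∃ W : Ω₂ → Path d, Measurable W ∧ ∀ᵐ ω ∂P₂, (W ω).1 = fun t => R ω * Θ t ω := by
  have hR_one : ∀ᵐ ω ∂P₂, 1 ≤ R ω :=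
    ae_of_ae_map hRm.aemeasurable (hR ▸ ae_le_paretoMeasure 1 1)
  refine exists_measurable_path_ae_eq (fun t => hRm.mul (hΘ.measurable t)) ?_
  filter_upwards [hΘ.paths, hR_one] with ω hω hr
  exact const_mul_mem_cadlagSpace hω (zero_le_one.trans hr)

lemma IsTilted.measure_epsilon_mem [SFinite P] [IsFiniteMeasure P₂]
    {Θ : (Fin d → ℝ) → Ω₂ → ℝ} {R : Ω₂ → ℝ} (hΘ : IsTilted P Z P₂ Θ)
    (hZ : ∀ t, Measurable (Z t)) (hX : Measurable X)
    (hXZ : ∀ᵐ ω ∂P, (X ω).1 = fun t => Z t ω) (hRm : Measurable R)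
    (hR : P₂.map R = paretoMeasure 1 1) (hRΘ : IndepFun R (fun ω t => Θ t ω) P₂) (δ : ℝ)
    {S : Set ℝ≥0∞} (hS : MeasurableSet S) :
    P₂ {ω | epsilon δ (fun t => R ω * Θ t ω) ∈ S} =
      tailMeasure P X {f | 1 < f.1 0 ∧ epsilon δ f.1 ∈ S} := by
  obtain ⟨W, hW, hWY⟩ := hΘ.exists_measurable_path_mul hRm hR
  have hm : MeasurableSet {f : Path d | epsilon δ f.1 ∈ S} := measurable_epsilon δ hS
  have hmap : P₂ {ω | epsilon δ (fun t => R ω * Θ t ω) ∈ S} =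
      P₂.map W {f | epsilon δ f.1 ∈ S} := by
    rw [Measure.map_apply hW hm]
    refine measure_congr (eventuallyEq_set.2 ?_)
    filter_upwards [hWY] with ω hω
    simp only [Set.mem_preimage, Set.mem_ofPred_eq, hω]
  rw [hmap, hΘ.map_eq_restrict_tailMeasure hZ hX hXZ hRm hR hRΘ hW hWY,
    Measure.restrict_apply hm, Set.inter_comm]
  rfl

end Main

end Berman

end

theorem mainTheorem10 {d : ℕ} (hd : 1 ≤ d)
    {Ω Ω₁ Ω₂ : Type*} [MeasurableSpace Ω] [MeasurableSpace Ω₁] [MeasurableSpace Ω₂]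
    -- the spectral random field `Z`
    (P : Measure Ω) [IsProbabilityMeasure P] (Z : (Fin d → ℝ) → Ω → ℝ)
    (hZ : Berman.IsSpectralField P Z)
    -- the stationary max-stable random field `X` with de Haan representation given by `Z`
    (P₁ : Measure Ω₁) [IsProbabilityMeasure P₁]
    (V : ℕ → Ω₁ → ℝ) (Zs : ℕ → (Fin d → ℝ) → Ω₁ → ℝ)
    (hVZ : Berman.IsDeHaanFamily P Z P₁ V Zs)
    (hX : Berman.IsStationary P₁ (Berman.maxStableField V Zs))
    -- the random field `Y = R Θ`
    (P₂ : Measure Ω₂) [IsProbabilityMeasure P₂]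
    (Θ : (Fin d → ℝ) → Ω₂ → ℝ) (hΘ : Berman.IsTilted P Z P₂ Θ)
    (R : Ω₂ → ℝ) (hRm : Measurable R) (hR : P₂.map R = paretoMeasure 1 1)
    (hRΘ : IndepFun R (fun ω t => Θ t ω) P₂)
    (Y : (Fin d → ℝ) → Ω₂ → ℝ) (hY : ∀ t ω, Y t ω = R ω * Θ t ω)
    (hS : P {ω | Berman.totalMass (fun t => Z t ω) = ∞} < 1) :
    -- the law of `ε_0(Y)` has no atoms in `[0, ∞)` if `Z` has continuous paths
    ((∀ᵐ ω ∂P, Continuous fun t => Z t ω) →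
      ∀ x : ℝ≥0∞, x ≠ ∞ → P₂ {ω | Berman.epsilon 0 (fun t => Y t ω) = x} = 0) ∧
    -- the Berman function is well defined and positive
    (∀ δ x : ℝ, 0 ≤ δ → 0 ≤ x →
      0 < P₂ {ω | ENNReal.ofReal x < Berman.epsilon δ (fun t => Y t ω) ∧
        Berman.epsilon δ (fun t => Y t ω) < ∞} →
      Tendsto (Berman.bermanRatio P Z δ x) atTop (𝓝 (Berman.bermanFunction P Z δ x)) ∧
        0 < Berman.bermanFunction P Z δ x ∧ Berman.bermanFunction P Z δ x < ∞) ∧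
    -- if `S_0 < ∞` almost surely, then `ε_δ(Y)` is almost surely finite
    ((∀ᵐ ω ∂P, Berman.totalMass (fun t => Z t ω) < ∞) →
      ∀ δ : ℝ, 0 ≤ δ → ∀ᵐ ω ∂P₂, Berman.epsilon δ (fun t => Y t ω) < ∞) := by
  obtain rfl : Y = fun t ω => R ω * Θ t ω := funext₂ hY
  obtain ⟨X, hXm, hXZ⟩ := Berman.exists_measurable_path_ae_eq hZ.measurable hZ.paths
  have hinv := Berman.shiftInvariant_tailMeasure hZ hXm hXZ hVZ hX
  have hlaw (δ : ℝ) {S : Set ℝ≥0∞} (hS : MeasurableSet S) :=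
    hΘ.measure_epsilon_mem hZ.measurable hXm hXZ hRm hR hRΘ δ hS
  have hone : Berman.tailMeasure P X {f | 1 < f.1 0} = 1 := by simpa using (hlaw 0 .univ).symm
  refine ⟨fun hc x hx => ?_, fun δ x hδ _ hpos => ?_, fun hmass δ hδ => ?_⟩
  · have hcX : ∀ᵐ ω ∂P, Continuous (X ω).1 := by filter_upwards [hc, hXZ] with ω h h' using h' ▸ h
    exact (hlaw 0 (measurableSet_singleton x)).trans
      (Berman.tailMeasure_epsilon_zero_eq hd hXm hcX hx)
  · obtain ⟨l, hl, hl0, hltop⟩ := hinv.exists_tendsto_exceedRatio hone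
      (Berman.tailMeasure_pos_sojourn_cube_lt_top hZ hXm hXZ) hδ
      (hpos.trans_eq (hlaw δ (measurableSet_Ioo (a := ENNReal.ofReal x))))
    rw [← funext (Berman.bermanRatio_eq_exceedRatio hXm hXZ δ x)] at hl
    rw [Berman.bermanFunction, hl.limUnder_eq]
    exact ⟨hl, hl0, hltop⟩
  · have hfin := Berman.ae_tailMeasure_epsilon_zero_lt_top hXm (P := P) <| by
      filter_upwards [hmass, hXZ] with ω h h' using h' ▸ h
    have hexceed := hinv.ae_epsilon_lt_top_of_nonneg (hone.trans_lt ENNReal.one_lt_top) hfin hδ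
    exact ae_iff.2 <| (hlaw δ (measurableSet_Iio (a := ∞)).compl).trans <| by
      simpa only [ae_iff, Classical.not_imp, Set.mem_compl_iff, Set.mem_Iio] using hexceed
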